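/- Let $\rho,\alpha,\beta,\gamma$ be real numbers with $\gamma\neq-(n\pi)^2$ for $n=0,1,2,\dots$. Let $\Delta w=w''$ with the Neumann domain $\{w\in H^2(0,1): w'(0)=w'(1)=0\}\subset L^2(0,1)$ (real-valued functions). Then $\gamma I-\Delta$ maps the Neumann domain bijectively onto $L^2(0,1)$, so that $$A=\Delta-\rho I+\alpha\beta(\gamma I-\Delta)^{-1}$$ is defined on the Neumann domain, and $A$ generates a $C_0$-semigroup on $L^2(0,1)$. Moreover, for each end $c\in\{0,1\}$ at which the control acts (with $c'$ the other end) and each end $o\in\{0,1\}$ at which the state is observed, the control system $$w_t=w_{xx}-\rho w+\alpha v,\qquad 0=v_{xx}-\gamma v+\beta w\qquad (0<x<1,\ t\ge 0),$$ $$w_x(c,t)=u(t),\quad w_x(c',t)=0,\quad v_x(0,t)=v_x(1,t)=0,\qquad y(t)=w(o,t),$$ is well-posed on the state space $L^2(0,1)$, in the following sense. A classical solution is a pair $w,v\in C([0,\infty);H^2(0,1))$ with $w\in C^1([0,\infty);L^2(0,1))$ that satisfies the equations and the boundary conditions for every $t\ge0$. (i) If $u\in C^2([0,\infty))$ and $w_0\in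 H^2(0,1)$ with $w_0'(c)=u(0)$ and $w_0'(c')=0$, there is a classical solution with $w(\cdot,0)=w_0$. For every input $u$, a classical solution is uniquely determined by $u$ and its initial state $w(\cdot,0)$. (ii) For every $T>0$ there is exactly one bounded linear operator from $L^2(0,1)\times L^2(0,T)$ to $C([0,T];L^2(0,1))\times L^2(0,T)$ that maps $(w(\cdot,0),u|_{(0,T)})$ to $(w|_{[0,T]},y|_{(0,T)})$ for every classical solution $(w,v)$ with input $u$ and output $y$. -/

import Mathlib

open MeasureTheory Set Filter Topology
open scoped NNReal

noncomputable section

namespace ParabolicElliptic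

/-! ### The spaces `L²(0,T)` and `H²(0,1)` -/

/-- The real Hilbert space `L²(0,T)`. -/
abbrev L2 (T : ℝ) : Type := Lp ℝ 2 (volume.restrict (Ioo (0 : ℝ) T))

/-- The state space `L²(0,1)`. -/
abbrev X : Type := L2 1

/-- `w ∈ L²(0,1)` has the representative `f`, which is continuously differentiable on `[0,1]` with
derivative `f₁`; moreover `f₁` is absolutely continuous on `[0,1]` and its (almost everywhere
defined) derivative is the element `w₂` of `L²(0,1)`. -/
structure IsH2Rep (w : X) (f f₁ : ℝ → ℝ) (w₂ : X) : Prop where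
  coe_ae : w =ᵐ[volume.restrict (Ioo (0 : ℝ) 1)] f
  hasDeriv : ∀ x ∈ Icc (0 : ℝ) 1, HasDerivWithinAt f (f₁ x) (Icc 0 1) x
  ac : AbsolutelyContinuousOnInterval f₁ 0 1
  deriv_ae : deriv f₁ =ᵐ[volume.restrict (Ioo (0 : ℝ) 1)] w₂

theorem ae_differentiableAt_of_ac {g : ℝ → ℝ} (h : AbsolutelyContinuousOnInterval g 0 1) :
    ∀ᵐ x ∂(volume.restrict (Ioo (0 : ℝ) 1)), DifferentiableAt ℝ g x := by
  rw [ae_restrict_iff' measurableSet_Ioo]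
  filter_upwards [h.ae_differentiableAt] with x hx hx'
  exact hx (by rw [uIcc_of_le zero_le_one]; exact Ioo_subset_Icc_self hx')

theorem IsH2Rep.add {w z : X} {f f₁ g g₁ : ℝ → ℝ} {w₂ z₂ : X}
    (hw : IsH2Rep w f f₁ w₂) (hz : IsH2Rep z g g₁ z₂) :
    IsH2Rep (w + z) (f + g) (f₁ + g₁) (w₂ + z₂) where
  coe_ae := (Lp.coeFn_add w z).trans (hw.coe_ae.add hz.coe_ae)
  hasDeriv x hx := (hw.hasDeriv x hx).add (hz.hasDeriv x hx)
  ac := hw.ac.add hz.ac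
  deriv_ae := by
    filter_upwards [ae_differentiableAt_of_ac hw.ac, ae_differentiableAt_of_ac hz.ac,
      hw.deriv_ae, hz.deriv_ae, Lp.coeFn_add w₂ z₂] with x h1 h2 h3 h4 h5
    rw [deriv_add h1 h2, h3, h4, h5, Pi.add_apply]

theorem IsH2Rep.smul {w : X} {f f₁ : ℝ → ℝ} {w₂ : X} (c : ℝ) (hw : IsH2Rep w f f₁ w₂) :
    IsH2Rep (c • w) (c • f) (c • f₁) (c • w₂) where
  coe_ae := (Lp.coeFn_smul c w).trans (hw.coe_ae.const_smul c)
  hasDeriv x hx := (hw.hasDeriv x hx).const_smul c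
  ac := hw.ac.const_smul c
  deriv_ae := by
    filter_upwards [ae_differentiableAt_of_ac hw.ac, hw.deriv_ae, Lp.coeFn_smul c w₂]
      with x h1 h2 h3
    rw [deriv_const_smul c h1, h2, h3, Pi.smul_apply]

theorem IsH2Rep.zero : IsH2Rep 0 0 0 0 where
  coe_ae := Lp.coeFn_zero _ _ _
  hasDeriv x _ := hasDerivWithinAt_const x _ (0 : ℝ)
  ac := (LipschitzWith.const (0 : ℝ)).lipschitzOnWith.absolutelyContinuousOnInterval (K := 0)
  deriv_ae := by
    filter_upwards [Lp.coeFn_zero ℝ 2 (volume.restrict (Ioo (0 : ℝ) 1))] with x hx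
    rw [hx]
    simp

/-- The representative, its derivative and the second derivative are unique. -/
theorem IsH2Rep.unique {w : X} {f f₁ g g₁ : ℝ → ℝ} {w₂ z₂ : X}
    (hw : IsH2Rep w f f₁ w₂) (hz : IsH2Rep w g g₁ z₂) :
    EqOn f g (Icc 0 1) ∧ EqOn f₁ g₁ (Icc 0 1) ∧ w₂ = z₂ := by
  have hae : f =ᵐ[volume.restrict (Icc (0 : ℝ) 1)] g := by
    rw [← restrict_Ioo_eq_restrict_Icc]
    exact hw.coe_ae.symm.trans hz.coe_ae
  have h0 : EqOn f g (Icc 0 1) := Measure.eqOn_Icc_of_ae_eq volume zero_ne_one hae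
    (fun x hx => (hw.hasDeriv x hx).continuousWithinAt)
    (fun x hx => (hz.hasDeriv x hx).continuousWithinAt)
  have h1 : EqOn f₁ g₁ (Icc 0 1) := fun x hx =>
    ((uniqueDiffOn_Icc zero_lt_one) x hx).eq_deriv _ (hw.hasDeriv x hx)
      ((hz.hasDeriv x hx).congr (fun y hy => h0 hy) (h0 hx))
  refine ⟨h0, h1, Lp.ext ?_⟩
  have h2 : ∀ᵐ x ∂(volume.restrict (Ioo (0 : ℝ) 1)), x ∈ Ioo (0 : ℝ) 1 :=
    ae_restrict_mem measurableSet_Ioo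
  filter_upwards [hw.deriv_ae, hz.deriv_ae, h2] with x h3 h4 h5
  rw [← h3, ← h4]
  refine Filter.EventuallyEq.deriv_eq ?_
  filter_upwards [isOpen_Ioo.mem_nhds h5] with y hy
  exact h1 (Ioo_subset_Icc_self hy)

/-- The Sobolev space `H²(0,1)`, as a subspace of `L²(0,1)`. -/
def H2 : Submodule ℝ X where
  carrier := {w | ∃ f f₁ w₂, IsH2Rep w f f₁ w₂}
  add_mem' := by
    rintro w z ⟨f, f₁, w₂, hw⟩ ⟨g, g₁, z₂, hz⟩
    exact ⟨_, _, _, hw.add hz⟩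
  zero_mem' := ⟨_, _, _, IsH2Rep.zero⟩
  smul_mem' := by
    rintro c w ⟨f, f₁, w₂, hw⟩
    exact ⟨_, _, _, hw.smul c⟩

/-- The `C¹([0,1])` representative of `w ∈ H²(0,1)`; `val w x` is `w(x)` for `x ∈ [0,1]`. -/
def val (w : H2) : ℝ → ℝ := w.2.choose

/-- The first derivative; `dx w x` is `w'(x)` for `x ∈ [0,1]`. -/
def dx (w : H2) : ℝ → ℝ := w.2.choose_spec.choose

/-- The second derivative `w'' ∈ L²(0,1)` of `w ∈ H²(0,1)`. -/
def dxx (w : H2) : X := w.2.choose_spec.choose_spec.choose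

theorem isH2Rep (w : H2) : IsH2Rep w (val w) (dx w) (dxx w) :=
  w.2.choose_spec.choose_spec.choose_spec

theorem val_dx_dxx_eq {w : H2} {f f₁ : ℝ → ℝ} {w₂ : X} (h : IsH2Rep w f f₁ w₂) :
    EqOn (val w) f (Icc 0 1) ∧ EqOn (dx w) f₁ (Icc 0 1) ∧ dxx w = w₂ :=
  (isH2Rep w).unique h

/-! ### The operator `A` -/

/-- The Laplacian `Δ w = w''` with domain `{w ∈ H²(0,1) | w'(0) = w'(1) = 0}`, as an unbounded
operator on `L²(0,1)`. -/
def neumannLaplacian : X →ₗ.[ℝ] X where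
  domain :=
    { carrier := {w | ∃ h : w ∈ H2, dx ⟨w, h⟩ 0 = 0 ∧ dx ⟨w, h⟩ 1 = 0}
      add_mem' := by
        rintro w z ⟨hw, hw0, hw1⟩ ⟨hz, hz0, hz1⟩
        have h := val_dx_dxx_eq (w := ⟨w + z, H2.add_mem hw hz⟩)
          ((isH2Rep ⟨w, hw⟩).add (isH2Rep ⟨z, hz⟩))
        exact ⟨H2.add_mem hw hz,
          by rw [h.2.1 (left_mem_Icc.2 zero_le_one), Pi.add_apply, hw0, hz0, add_zero],
          by rw [h.2.1 (right_mem_Icc.2 zero_le_one), Pi.add_apply, hw1, hz1, add_zero]⟩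
      zero_mem' := by
        have h := val_dx_dxx_eq (w := (0 : H2)) IsH2Rep.zero
        exact ⟨H2.zero_mem, h.2.1 (left_mem_Icc.2 zero_le_one),
          h.2.1 (right_mem_Icc.2 zero_le_one)⟩
      smul_mem' := by
        rintro c w ⟨hw, hw0, hw1⟩
        have h := val_dx_dxx_eq (w := ⟨c • w, H2.smul_mem c hw⟩) ((isH2Rep ⟨w, hw⟩).smul c)
        exact ⟨H2.smul_mem c hw,
          by rw [h.2.1 (left_mem_Icc.2 zero_le_one), Pi.smul_apply, hw0, smul_zero],
          by rw [h.2.1 (right_mem_Icc.2 zero_le_one), Pi.smul_apply, hw1, smul_zero]⟩ }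
  toFun :=
    { toFun := fun w => dxx ⟨w.1, w.2.choose⟩
      map_add' := fun w z => (val_dx_dxx_eq (w := ⟨w.1 + z.1, H2.add_mem w.2.choose z.2.choose⟩)
        ((isH2Rep ⟨w.1, w.2.choose⟩).add (isH2Rep ⟨z.1, z.2.choose⟩))).2.2
      map_smul' := fun c w => (val_dx_dxx_eq (w := ⟨c • w.1, H2.smul_mem c w.2.choose⟩)
        ((isH2Rep ⟨w.1, w.2.choose⟩).smul c)).2.2 }

/-- The operator `γI - Δ`, with the domain of the Neumann Laplacian. -/
def ellipticOp (γ : ℝ) : X →ₗ.[ℝ] X := (γ • LinearMap.id : X →ₗ[ℝ] X) +ᵥ (-neumannLaplacian)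

/-- The operator `A = Δ - ρI + αβ (γI - Δ)⁻¹`, on the natural domain of the sum. -/
def opA (ρ α β γ : ℝ) : X →ₗ.[ℝ] X :=
  (-ρ • LinearMap.id : X →ₗ[ℝ] X) +ᵥ (neumannLaplacian + (α * β) • (ellipticOp γ).inverse)

/-! ### Strongly continuous semigroups -/

/-- `S` is a `C₀`-semigroup of bounded operators on `E`. -/
structure IsC0Semigroup {E : Type*} [NormedAddCommGroup E] [NormedSpace ℝ E]
    (S : ℝ≥0 → E →L[ℝ] E) : Prop where
  map_zero : S 0 = ContinuousLinearMap.id ℝ E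
  map_add : ∀ s t, S (s + t) = (S s).comp (S t)
  strong_cont : ∀ x, Tendsto (fun t => S t x) (𝓝[>] 0) (𝓝 x)

/-- `A` is the infinitesimal generator of `S`: `x ∈ D(A)` and `A x = y` if and only if
`(S t x - x) / t → y` as `t ↓ 0`. -/
def IsGenerator {E : Type*} [NormedAddCommGroup E] [NormedSpace ℝ E]
    (S : ℝ≥0 → E →L[ℝ] E) (A : E →ₗ.[ℝ] E) : Prop :=
  ∀ x y, (x, y) ∈ A.graph ↔ Tendsto (fun t : ℝ≥0 => (t : ℝ)⁻¹ • (S t x - x)) (𝓝[>] 0) (𝓝 y)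

/-- `A` generates a `C₀`-semigroup. -/
def GeneratesC0Semigroup {E : Type*} [NormedAddCommGroup E] [NormedSpace ℝ E]
    (A : E →ₗ.[ℝ] E) : Prop :=
  ∃ S : ℝ≥0 → E →L[ℝ] E, IsC0Semigroup S ∧ IsGenerator S A

/-! ### The boundary control system -/

/-- The two ends of the interval `[0,1]`. -/
inductive Endpoint
  | left
  | right

/-- The position of an end. -/
def Endpoint.pos : Endpoint → ℝ
  | left => 0
  | right => 1

/-- The opposite end. -/
def Endpoint.other : Endpoint → Endpoint
  | left => right
  | right => left

/-- `(w, v)` is a classical solution on `[0,∞)` of the parabolic-elliptic system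
`w_t = w_xx - ρ w + α v`, `0 = v_xx - γ v + β w`, with `w_x = u(t)` at the end `c`, `w_x = 0` at the
other end, and `v_x = 0` at both ends: `w ∈ C¹([0,∞); L²(0,1))`, `w(t), v(t) ∈ H²(0,1)` for
`t ≥ 0`, `w` and `v` are continuous in `H²(0,1)`, and the equations hold for every `t ≥ 0`.
Only the values for `t ≥ 0` matter. -/
structure IsClassicalSolution (ρ α β γ : ℝ) (c : Endpoint) (u : ℝ → ℝ) (w v : ℝ → H2) : Prop where
  w_cont : ContinuousOn (fun t => (w t : X)) (Ici 0)
  w_dxx_cont : ContinuousOn (fun t => dxx (w t)) (Ici 0)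
  v_cont : ContinuousOn (fun t => (v t : X)) (Ici 0)
  v_dxx_cont : ContinuousOn (fun t => dxx (v t)) (Ici 0)
  parabolic : ∀ t ∈ Ici (0 : ℝ), HasDerivWithinAt (fun t => (w t : X))
    (dxx (w t) - ρ • (w t : X) + α • (v t : X)) (Ici 0) t
  elliptic : ∀ t ∈ Ici (0 : ℝ), 0 = dxx (v t) - γ • (v t : X) + β • (w t : X)
  w_control : ∀ t ∈ Ici (0 : ℝ), dx (w t) c.pos = u t
  w_other : ∀ t ∈ Ici (0 : ℝ), dx (w t) c.other.pos = 0
  v_left : ∀ t ∈ Ici (0 : ℝ), dx (v t) 0 = 0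
  v_right : ∀ t ∈ Ici (0 : ℝ), dx (v t) 1 = 0

/-- Well-posedness, on the state space `L²(0,1)`, of the system with control `w_x = u(t)` at the end
`c` and observation `y(t) = w(o,t)` at the end `o`.

* For every `u ∈ C²([0,∞))` and every `w₀ ∈ H²(0,1)` that satisfies the boundary conditions at time
  `0`, there is exactly one classical solution with initial state `w₀`.
* For every `T > 0` the map (initial state, input) ↦ (state trajectory, output) given by the
  classical solutions has exactly one extension to a bounded linear operator from
  `L²(0,1) × L²(0,T)` to `C([0,T]; L²(0,1)) × L²(0,T)`. -/
structure IsWellPosed (ρ α β γ : ℝ) (c o : Endpoint) : Prop where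
  exists_classical : ∀ (u : ℝ → ℝ) (w₀ : H2), ContDiffOn ℝ 2 u (Ici 0) →
    dx w₀ c.pos = u 0 → dx w₀ c.other.pos = 0 →
    ∃ w v : ℝ → H2, IsClassicalSolution ρ α β γ c u w v ∧ w 0 = w₀
  unique_classical : ∀ (u : ℝ → ℝ) (w v w' v' : ℝ → H2), IsClassicalSolution ρ α β γ c u w v →
    IsClassicalSolution ρ α β γ c u w' v' → w 0 = w' 0 → EqOn w w' (Ici 0) ∧ EqOn v v' (Ici 0)
  exists_unique_extension : ∀ T : ℝ, 0 < T →
    ∃! P : X × L2 T →L[ℝ] C(Icc (0 : ℝ) T, X) × L2 T,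
      ∀ (u : ℝ → ℝ) (w v : ℝ → H2), IsClassicalSolution ρ α β γ c u w v →
        ∀ U : L2 T, U =ᵐ[volume.restrict (Ioo (0 : ℝ) T)] u →
          (∀ t : Icc (0 : ℝ) T, (P (w 0, U)).1 t = w t) ∧
          (P (w 0, U)).2 =ᵐ[volume.restrict (Ioo (0 : ℝ) T)] fun t => val (w t) o.pos

end ParabolicElliptic

end

open MeasureTheory Set Filter Topology
open scoped NNReal

noncomputable section

namespace ParabolicElliptic

/-! ### Integration on the unit interval -/

/-! The functions `cos (n π x)` form an orthogonal basis of `L²(0,1)` and diagonalize the Neumann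
Laplacian completely: by `mem_graph_neumann_iff_coef`, a pair `(w, g)` lies in its graph exactly
when every cosine coefficient of `g` is `-(n π)²` times that of `w`. All operators in the problem
then become multipliers. The symbol `γ + (n π)²` of `γI - Δ` never vanishes and tends to infinity,
so its inverse is an everywhere defined bounded operator. The symbol of `A` is real and bounded
above, so the multipliers `exp (μ n t)` form a semigroup, and its generator is `A` by
`generates_of_coef`.

For the control system, the elliptic equation gives `v = β (γI - Δ)⁻¹ w`, which leaves one parabolic
equation with inhomogeneous Neumann data. Subtracting `u(t) g`, with `g` a fixed lift of the
boundary condition, turns it into `z' = A z + f` with `f` in `C¹`; this has a strict solution by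
`exists_strict_solution`, whence `exists_classical`.

Everything else rests on `IsClassicalSolution.energy`. Pairing the equation with `w` produces the
dissipation `-2 ∫ w_x²` and a boundary term in `u(t) w(c,t)`. The trace inequality `val_sq_le`
absorbs both `w(c,t)²` and the output `w(o,t)²` into the dissipation, so Grönwall's argument bounds
the state and the output by the initial state and the input in `L²`. Applied to differences, this is
uniqueness. Applied to the linear relation formed by all classical solutions, whose data are dense
by `classicalRel_dense`, it gives the unique bounded extension through `existsUnique_clm_of_dense`.
-/

theorem inner_eq_intervalIntegral (w z : X) : inner ℝ w z = ∫ x in (0 : ℝ)..1, w x * z x := by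
  rw [L2.inner_def, intervalIntegral.integral_of_le zero_le_one, integral_Ioc_eq_integral_Ioo]
  exact integral_congr_ae (Eventually.of_forall fun x => by simp [mul_comm])

theorem intervalIntegral_congr_ae_Ioo {f g : ℝ → ℝ}
    (h : f =ᵐ[volume.restrict (Ioo (0 : ℝ) 1)] g) :
    ∫ x in (0 : ℝ)..1, f x = ∫ x in (0 : ℝ)..1, g x := by
  rw [intervalIntegral.integral_of_le zero_le_one, intervalIntegral.integral_of_le zero_le_one,
    integral_Ioc_eq_integral_Ioo, integral_Ioc_eq_integral_Ioo]
  exact integral_congr_ae h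

theorem ae_Ioo : ∀ᵐ x ∂(volume.restrict (Ioo (0 : ℝ) 1)), x ∈ Ioo (0 : ℝ) 1 :=
  ae_restrict_mem measurableSet_Ioo

theorem memLp_of_continuous {f : ℝ → ℝ} (hf : Continuous f) (T : ℝ) :
    MemLp f 2 (volume.restrict (Ioo (0 : ℝ) T)) := by
  obtain ⟨C, hC⟩ := (isCompact_Icc (a := (0 : ℝ)) (b := T)).exists_bound_of_continuousOn
    hf.continuousOn
  refine MemLp.of_bound hf.aestronglyMeasurable C ?_
  filter_upwards [ae_restrict_mem measurableSet_Ioo] with x hx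
  exact hC x (Ioo_subset_Icc_self hx)

/-- The element of `L²(0,1)` given by a continuous function. -/
def ofCont (f : C(ℝ, ℝ)) : X := (memLp_of_continuous f.continuous 1).toLp f

theorem ofCont_ae (f : C(ℝ, ℝ)) : ofCont f =ᵐ[volume.restrict (Ioo (0 : ℝ) 1)] f :=
  MemLp.coeFn_toLp _

theorem intervalIntegrable_coe (w : X) : IntervalIntegrable w volume 0 1 := by
  rw [intervalIntegrable_iff_integrableOn_Ioo_of_le zero_le_one]
  exact (Lp.memLp w).integrable one_le_two

theorem inner_ofCont (w : X) (f : C(ℝ, ℝ)) :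
    inner ℝ w (ofCont f) = ∫ x in (0 : ℝ)..1, w x * f x := by
  rw [inner_eq_intervalIntegral]
  refine intervalIntegral_congr_ae_Ioo ?_
  filter_upwards [ofCont_ae f] with x hx
  rw [hx]

/-! ### Green's formulas in `H²(0,1)` -/

theorem continuousOn_dx (w : H2) : ContinuousOn (dx w) (Icc 0 1) := by
  simpa [uIcc_of_le] using (isH2Rep w).ac.continuousOn

theorem continuousOn_val (w : H2) : ContinuousOn (val w) (Icc 0 1) := fun x hx =>
  ((isH2Rep w).hasDeriv x hx).continuousWithinAt

theorem absolutelyContinuous_of_hasDerivWithinAt {φ φ' : ℝ → ℝ}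
    (hφ : ∀ x ∈ Icc (0 : ℝ) 1, HasDerivWithinAt φ (φ' x) (Icc 0 1) x)
    (hφ' : ContinuousOn φ' (Icc 0 1)) : AbsolutelyContinuousOnInterval φ 0 1 := by
  obtain ⟨C, hC⟩ := (isCompact_Icc (a := (0 : ℝ)) (b := 1)).exists_bound_of_continuousOn hφ'
  have h := (convex_Icc (0 : ℝ) 1).lipschitzOnWith_of_nnnorm_hasDerivWithin_le (C := C.toNNReal)
    hφ (fun x hx => by
      rw [← NNReal.coe_le_coe, coe_nnnorm]
      exact (hC x hx).trans (Real.le_coe_toNNReal C))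
  rw [← uIcc_of_le zero_le_one] at h
  exact h.absolutelyContinuousOnInterval

/-- Since `w'` is only absolutely continuous, the integration by parts is the one for absolutely
continuous functions; `φ` qualifies because a bounded derivative makes it Lipschitz. -/
theorem integral_dxx_mul (w : H2) {φ φ' : ℝ → ℝ}
    (hφ : ∀ x ∈ Icc (0 : ℝ) 1, HasDerivWithinAt φ (φ' x) (Icc 0 1) x)
    (hφ' : ContinuousOn φ' (Icc 0 1)) :
    ∫ x in (0 : ℝ)..1, dxx w x * φ x =
      dx w 1 * φ 1 - dx w 0 * φ 0 - ∫ x in (0 : ℝ)..1, dx w x * φ' x := by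
  have h := AbsolutelyContinuousOnInterval.integral_mul_deriv_eq_deriv_mul
    (absolutelyContinuous_of_hasDerivWithinAt hφ hφ') (isH2Rep w).ac
  have h1 : ∫ x in (0 : ℝ)..1, φ x * deriv (dx w) x = ∫ x in (0 : ℝ)..1, dxx w x * φ x := by
    refine intervalIntegral_congr_ae_Ioo ?_
    filter_upwards [(isH2Rep w).deriv_ae] with x hx
    rw [hx, mul_comm]
  have h2 : ∫ x in (0 : ℝ)..1, deriv φ x * dx w x = ∫ x in (0 : ℝ)..1, dx w x * φ' x := by
    refine intervalIntegral_congr_ae_Ioo ?_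
    filter_upwards [ae_Ioo] with x hx
    rw [((hφ x (Ioo_subset_Icc_self hx)).hasDerivAt (Icc_mem_nhds hx.1 hx.2)).deriv, mul_comm]
  rw [h1, h2] at h
  rw [h]
  ring

theorem integral_dx_mul (w : H2) {φ φ' : ℝ → ℝ}
    (hφ : ∀ x ∈ Icc (0 : ℝ) 1, HasDerivWithinAt φ (φ' x) (Icc 0 1) x)
    (hφ' : ContinuousOn φ' (Icc 0 1)) :
    ∫ x in (0 : ℝ)..1, dx w x * φ x =
      val w 1 * φ 1 - val w 0 * φ 0 - ∫ x in (0 : ℝ)..1, val w x * φ' x := by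
  have hw := absolutelyContinuous_of_hasDerivWithinAt (isH2Rep w).hasDeriv (continuousOn_dx w)
  have h := AbsolutelyContinuousOnInterval.integral_mul_deriv_eq_deriv_mul
    hw (absolutelyContinuous_of_hasDerivWithinAt hφ hφ')
  have h1 : ∫ x in (0 : ℝ)..1, val w x * deriv φ x = ∫ x in (0 : ℝ)..1, val w x * φ' x := by
    refine intervalIntegral_congr_ae_Ioo ?_
    filter_upwards [ae_Ioo] with x hx
    rw [((hφ x (Ioo_subset_Icc_self hx)).hasDerivAt (Icc_mem_nhds hx.1 hx.2)).deriv]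
  have h2 : ∫ x in (0 : ℝ)..1, deriv (val w) x * φ x = ∫ x in (0 : ℝ)..1, dx w x * φ x := by
    refine intervalIntegral_congr_ae_Ioo ?_
    filter_upwards [ae_Ioo] with x hx
    rw [(((isH2Rep w).hasDeriv x (Ioo_subset_Icc_self hx)).hasDerivAt
      (Icc_mem_nhds hx.1 hx.2)).deriv]
  rw [h1, h2] at h
  linarith

theorem integral_val_mul (w : H2) (φ : ℝ → ℝ) :
    ∫ x in (0 : ℝ)..1, val w x * φ x = ∫ x in (0 : ℝ)..1, (w : X) x * φ x := by
  refine intervalIntegral_congr_ae_Ioo ?_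
  filter_upwards [(isH2Rep w).coe_ae] with x hx
  rw [hx]

/-- Green's second formula, tested against a `C²` function. -/
theorem green (w : H2) (p p₁ p₂ : C(ℝ, ℝ)) (h₁ : ∀ x, HasDerivAt p (p₁ x) x)
    (h₂ : ∀ x, HasDerivAt p₁ (p₂ x) x) :
    inner ℝ (dxx w) (ofCont p) = dx w 1 * p 1 - dx w 0 * p 0 - val w 1 * p₁ 1 + val w 0 * p₁ 0
      + inner ℝ (w : X) (ofCont p₂) := by
  rw [inner_ofCont, inner_ofCont,
    integral_dxx_mul w (fun x _ => (h₁ x).hasDerivWithinAt) p₁.continuous.continuousOn,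
    integral_dx_mul w (fun x _ => (h₂ x).hasDerivWithinAt) p₂.continuous.continuousOn,
    integral_val_mul]
  ring

theorem inner_dxx_self (w : H2) :
    inner ℝ (dxx w) (w : X) =
      dx w 1 * val w 1 - dx w 0 * val w 0 - ∫ x in (0 : ℝ)..1, dx w x ^ 2 := by
  have h := integral_dxx_mul w (isH2Rep w).hasDeriv (continuousOn_dx w)
  rw [inner_eq_intervalIntegral]
  simp only [pow_two]
  rw [← h]
  refine intervalIntegral_congr_ae_Ioo ?_
  filter_upwards [(isH2Rep w).coe_ae] with x hx
  rw [hx]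

theorem norm_sq_eq_integral_val (w : H2) :
    ‖(w : X)‖ ^ 2 = ∫ x in (0 : ℝ)..1, val w x ^ 2 := by
  rw [← real_inner_self_eq_norm_sq, inner_eq_intervalIntegral]
  refine intervalIntegral_congr_ae_Ioo ?_
  filter_upwards [(isH2Rep w).coe_ae] with x hx
  rw [hx, pow_two]

/-! ### Construction of elements of `H²(0,1)` -/

/-- `a + b x + ∫₀ˣ ∫₀ʸ g` is an element of `H²(0,1)` with second derivative `g`. -/
theorem exists_h2 (a b : ℝ) (g : X) :
    ∃ w : H2, val w 0 = a ∧ dx w 0 = b ∧ dx w 1 = b + ∫ x in (0 : ℝ)..1, g x ∧ dxx w = g := by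
  have hg := intervalIntegrable_coe g
  set f₁ : ℝ → ℝ := fun x => b + ∫ y in (0 : ℝ)..x, g y with hf₁
  have hac : AbsolutelyContinuousOnInterval f₁ 0 1 := by
    have h0 : AbsolutelyContinuousOnInterval (fun _ : ℝ => b) 0 1 :=
      (LipschitzWith.const b).lipschitzOnWith.absolutelyContinuousOnInterval (K := 0)
    exact h0.add (hg.absolutelyContinuousOnInterval_intervalIntegral (by simp))
  have hcont : ContinuousOn f₁ (Icc 0 1) := by simpa [uIcc_of_le] using hac.continuousOn
  set f : ℝ → ℝ := fun x => a + ∫ y in (0 : ℝ)..x, f₁ y with hf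
  have hder : ∀ x ∈ Icc (0 : ℝ) 1, HasDerivWithinAt f (f₁ x) (Icc 0 1) x := by
    intro x hx
    have : Fact (x ∈ Icc (0 : ℝ) 1) := ⟨hx⟩
    refine HasDerivWithinAt.const_add a ?_
    refine intervalIntegral.integral_hasDerivWithinAt_right (t := Icc 0 1) ?_ ?_ (hcont x hx)
    · refine ContinuousOn.intervalIntegrable (hcont.mono ?_)
      rw [uIcc_of_le hx.1]
      exact Icc_subset_Icc_right hx.2
    · exact hcont.stronglyMeasurableAtFilter_nhdsWithin measurableSet_Icc x
  have hcf : ContinuousOn f (Icc 0 1) := fun x hx => (hder x hx).continuousWithinAt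
  have hmem : MemLp f 2 (volume.restrict (Ioo (0 : ℝ) 1)) := by
    obtain ⟨C, hC⟩ := (isCompact_Icc (a := (0 : ℝ)) (b := 1)).exists_bound_of_continuousOn hcf
    refine MemLp.of_bound
      ((hcf.mono Ioo_subset_Icc_self).aestronglyMeasurable measurableSet_Ioo) C ?_
    filter_upwards [ae_Ioo] with x hx
    exact hC x (Ioo_subset_Icc_self hx)
  have hrep : IsH2Rep (hmem.toLp f) f f₁ g := by
    refine ⟨hmem.coeFn_toLp, hder, hac, ?_⟩
    rw [EventuallyEq, ae_restrict_iff' measurableSet_Ioo]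
    filter_upwards [hg.ae_hasDerivAt_integral] with x hx hx'
    have hx'' : x ∈ uIcc (0 : ℝ) 1 := by
      rw [uIcc_of_le zero_le_one]; exact Ioo_subset_Icc_self hx'
    exact ((hx hx'' 0 (by simp)).const_add b).deriv
  obtain ⟨h0, h1, h2⟩ := val_dx_dxx_eq (w := ⟨hmem.toLp f, _, _, _, hrep⟩) hrep
  refine ⟨⟨hmem.toLp f, _, _, _, hrep⟩, ?_, ?_, ?_, h2⟩
  · rw [h0 (by simp)]; simp [hf]
  · rw [h1 (by simp)]; simp [hf₁]
  · rw [h1 (by simp)]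

/-! ### Linearity of the traces and derivatives -/

theorem add_rules (w z : H2) : EqOn (val (w + z)) (val w + val z) (Icc 0 1) ∧
    EqOn (dx (w + z)) (dx w + dx z) (Icc 0 1) ∧ dxx (w + z) = dxx w + dxx z :=
  val_dx_dxx_eq (w := w + z) ((isH2Rep w).add (isH2Rep z))

theorem smul_rules (c : ℝ) (w : H2) : EqOn (val (c • w)) (c • val w) (Icc 0 1) ∧
    EqOn (dx (c • w)) (c • dx w) (Icc 0 1) ∧ dxx (c • w) = c • dxx w :=
  val_dx_dxx_eq (w := c • w) ((isH2Rep w).smul c)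

theorem Endpoint.pos_mem (c : Endpoint) : c.pos ∈ Icc (0 : ℝ) 1 := by
  cases c <;> simp [Endpoint.pos]

/-- The second derivative as a linear map. -/
def dxxₗ : H2 →ₗ[ℝ] X where
  toFun := dxx
  map_add' w z := (add_rules w z).2.2
  map_smul' c w := (smul_rules c w).2.2

/-- The value at a point of `[0,1]` as a linear map. -/
def valₗ {x : ℝ} (hx : x ∈ Icc (0 : ℝ) 1) : H2 →ₗ[ℝ] ℝ where
  toFun w := val w x
  map_add' w z := (add_rules w z).1 hx
  map_smul' c w := (smul_rules c w).1 hx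

/-- The derivative at a point of `[0,1]` as a linear map. -/
def dxₗ {x : ℝ} (hx : x ∈ Icc (0 : ℝ) 1) : H2 →ₗ[ℝ] ℝ where
  toFun w := dx w x
  map_add' w z := (add_rules w z).2.1 hx
  map_smul' c w := (smul_rules c w).2.1 hx

/-! ### Traces at the ends depend continuously on the `H²` norm -/

/-- A polynomial as a continuous function. -/
def polyC (p : Polynomial ℝ) : C(ℝ, ℝ) := ⟨fun x => p.eval x, p.continuous⟩

theorem green_poly (w : H2) (p : Polynomial ℝ) :
    inner ℝ (dxx w) (ofCont (polyC p)) = dx w 1 * p.eval 1 - dx w 0 * p.eval 0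
      - val w 1 * p.derivative.eval 1 + val w 0 * p.derivative.eval 0
      + inner ℝ (w : X) (ofCont (polyC p.derivative.derivative)) :=
  green w (polyC p) (polyC p.derivative) (polyC p.derivative.derivative)
    (fun x => p.hasDerivAt x) (fun x => p.derivative.hasDerivAt x)

/-- Testing Green's formula with a cubic Hermite polynomial isolates one of the four boundary terms.
The traces thus become inner products of `w''` and `w` with fixed elements, so they are continuous
in the `H²` norm. -/
theorem exists_trace_rep (c : Endpoint) : ∃ a b a' b' : X, ∀ w : H2,
    val w c.pos = inner ℝ (dxx w) a + inner ℝ (w : X) b ∧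
    dx w c.pos = inner ℝ (dxx w) a' + inner ℝ (w : X) b' := by
  cases c
  · refine ⟨ofCont (polyC (Polynomial.X - 2 * Polynomial.X ^ 2 + Polynomial.X ^ 3)),
      -ofCont (polyC (Polynomial.derivative (Polynomial.derivative (Polynomial.X - 2 * Polynomial.X ^ 2 + Polynomial.X ^ 3)))),
      -ofCont (polyC (1 - 3 * Polynomial.X ^ 2 + 2 * Polynomial.X ^ 3)),
      ofCont (polyC (Polynomial.derivative (Polynomial.derivative (1 - 3 * Polynomial.X ^ 2 + 2 * Polynomial.X ^ 3)))), fun w => ⟨?_, ?_⟩⟩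
    · rw [green_poly, inner_neg_right]
      simp [Endpoint.pos]
      ring
    · rw [inner_neg_right, green_poly]
      simp [Endpoint.pos]
      ring
  · refine ⟨ofCont (polyC (Polynomial.X ^ 2 - Polynomial.X ^ 3)),
      -ofCont (polyC (Polynomial.derivative (Polynomial.derivative (Polynomial.X ^ 2 - Polynomial.X ^ 3)))),
      ofCont (polyC (3 * Polynomial.X ^ 2 - 2 * Polynomial.X ^ 3)),
      -ofCont (polyC (Polynomial.derivative (Polynomial.derivative (3 * Polynomial.X ^ 2 - 2 * Polynomial.X ^ 3)))), fun w => ⟨?_, ?_⟩⟩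
    · rw [green_poly, inner_neg_right]
      simp [Endpoint.pos]
      ring
    · rw [green_poly, inner_neg_right]
      simp [Endpoint.pos]
      ring

theorem continuousOn_traces {w : ℝ → H2} {s : Set ℝ} (h : ContinuousOn (fun t => (w t : X)) s)
    (h₂ : ContinuousOn (fun t => dxx (w t)) s) (c : Endpoint) :
    ContinuousOn (fun t => val (w t) c.pos) s ∧ ContinuousOn (fun t => dx (w t) c.pos) s := by
  obtain ⟨a, b, a', b', hab⟩ := exists_trace_rep c
  exact ⟨((h₂.inner continuousOn_const).add (h.inner continuousOn_const)).congr
      fun t _ => (hab (w t)).1,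
    ((h₂.inner continuousOn_const).add (h.inner continuousOn_const)).congr
      fun t _ => (hab (w t)).2⟩

/-- The trace inequality. -/
theorem val_sq_le (w : H2) (o : Endpoint) :
    val w o.pos ^ 2 ≤ 2⁻¹ * (∫ x in (0 : ℝ)..1, dx w x ^ 2) + 3 * ‖(w : X)‖ ^ 2 := by
  -- The weight `p` is affine with slope `±1`. It is chosen below to vanish at the end opposite to
  -- `o` and to have modulus `1` at `o`, so that the increment of `p w²` is `w(o)²`. The factor
  -- `2⁻¹` on `∫ w_x²` leaves room for using the inequality twice in the energy estimate.
  have key : ∀ p : ℝ → ℝ, (∃ r : ℝ, |r| = 1 ∧ ∀ x, HasDerivAt p r x) →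
      (∀ x ∈ Icc (0 : ℝ) 1, |p x| ≤ 1) →
      |p 1 * val w 1 ^ 2 - p 0 * val w 0 ^ 2| ≤
        2⁻¹ * (∫ x in (0 : ℝ)..1, dx w x ^ 2) + 3 * ‖(w : X)‖ ^ 2 := by
    rintro p ⟨r, hr, hp⟩ hb
    have hv := continuousOn_val w
    have hd := continuousOn_dx w
    have hpc : Continuous p := continuous_iff_continuousAt.2 fun x => (hp x).continuousAt
    have hder : ∀ x ∈ Ioo (0 : ℝ) 1, HasDerivAt (fun x => p x * val w x ^ 2)
        (r * val w x ^ 2 + p x * (2 * val w x * dx w x)) x := by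
      intro x hx
      have h1 := ((isH2Rep w).hasDeriv x (Ioo_subset_Icc_self hx)).hasDerivAt
        (Icc_mem_nhds hx.1 hx.2)
      convert! (hp x).mul (h1.pow 2) using 1
      simp
    have hc : ContinuousOn (fun x => r * val w x ^ 2 + p x * (2 * val w x * dx w x))
        (uIcc 0 1) := by
      rw [uIcc_of_le zero_le_one]
      fun_prop
    have hFTC := intervalIntegral.integral_eq_sub_of_hasDerivAt_of_le zero_le_one
      (f := fun x => p x * val w x ^ 2) (by fun_prop) hder hc.intervalIntegrable
    have hcd : ContinuousOn (fun x => 2⁻¹ * dx w x ^ 2) (uIcc 0 1) := by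
      rw [uIcc_of_le zero_le_one]; fun_prop
    have hcv : ContinuousOn (fun x => 3 * val w x ^ 2) (uIcc 0 1) := by
      rw [uIcc_of_le zero_le_one]; fun_prop
    rw [← hFTC, norm_sq_eq_integral_val, ← intervalIntegral.integral_const_mul,
      ← intervalIntegral.integral_const_mul, ← intervalIntegral.integral_add
        hcd.intervalIntegrable hcv.intervalIntegrable]
    refine (intervalIntegral.abs_integral_le_integral_abs zero_le_one).trans ?_
    refine intervalIntegral.integral_mono_on zero_le_one hc.abs.intervalIntegrable
      (hcd.add hcv).intervalIntegrable ?_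
    intro x hx
    calc |r * val w x ^ 2 + p x * (2 * val w x * dx w x)|
        ≤ |r * val w x ^ 2| + |p x * (2 * val w x * dx w x)| := abs_add_le _ _
      _ ≤ val w x ^ 2 + |2 * val w x * dx w x| := by
          rw [abs_mul, abs_mul (p x), hr, one_mul, abs_of_nonneg (sq_nonneg (val w x))]
          have := mul_le_mul_of_nonneg_right (hb x hx) (abs_nonneg (2 * val w x * dx w x))
          linarith
      _ ≤ 2⁻¹ * dx w x ^ 2 + 3 * val w x ^ 2 := by
          have : |2 * val w x * dx w x| ≤ 2⁻¹ * dx w x ^ 2 + 2 * val w x ^ 2 :=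
            abs_le.2 ⟨by nlinarith [sq_nonneg (dx w x + 2 * val w x)],
              by nlinarith [sq_nonneg (dx w x - 2 * val w x)]⟩
          linarith
  cases o
  · have h := key (fun x => x - 1) ⟨1, by simp, fun x => (hasDerivAt_id x).sub_const 1⟩
      (fun x hx => abs_le.2 ⟨by linarith [hx.1], by linarith [hx.2]⟩)
    simpa [Endpoint.pos] using h
  · have h := key (fun x => x) ⟨1, by simp, fun x => hasDerivAt_id x⟩
      (fun x hx => abs_le.2 ⟨by linarith [hx.1], hx.2⟩)
    simpa [Endpoint.pos] using h

/-! ### The cosine basis of `L²(0,1)` -/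

/-- The function `cos (n π x)`. -/
def cosC (n : ℤ) : C(ℝ, ℝ) := ⟨fun x => Real.cos (n * Real.pi * x), by fun_prop⟩

theorem integral_cos (k : ℤ) (hk : k ≠ 0) :
    ∫ x in (0 : ℝ)..1, Real.cos (k * Real.pi * x) = 0 := by
  have hk' : (k : ℝ) * Real.pi ≠ 0 := mul_ne_zero (by exact_mod_cast hk) Real.pi_ne_zero
  rw [intervalIntegral.integral_comp_mul_left (fun x => Real.cos x) hk']
  simp [Real.sin_int_mul_pi]

theorem inner_cosC (m n : ℤ) : inner ℝ (ofCont (cosC m)) (ofCont (cosC n)) =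
    2⁻¹ * (∫ x in (0 : ℝ)..1, Real.cos ((m - n : ℤ) * Real.pi * x)) +
      2⁻¹ * ∫ x in (0 : ℝ)..1, Real.cos ((m + n : ℤ) * Real.pi * x) := by
  rw [inner_ofCont, ← intervalIntegral.integral_const_mul, ← intervalIntegral.integral_const_mul,
    ← intervalIntegral.integral_add (Continuous.intervalIntegrable (by fun_prop) _ _)
      (Continuous.intervalIntegrable (by fun_prop) _ _)]
  refine intervalIntegral_congr_ae_Ioo ?_
  filter_upwards [ofCont_ae (cosC m)] with x hx
  rw [hx]
  simp only [cosC, ContinuousMap.coe_mk, Int.cast_sub, Int.cast_add, sub_mul, add_mul,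
    Real.cos_sub, Real.cos_add]
  ring

theorem ofCont_cosC_ne_zero (n : ℤ) : ofCont (cosC n) ≠ 0 := by
  intro h
  have h1 := inner_cosC n n
  rw [h, inner_zero_left, sub_self] at h1
  by_cases hn : n = 0
  · subst hn
    norm_num at h1
  · rw [integral_cos (n + n) (by omega)] at h1
    norm_num at h1

/-- The normalized cosine functions. -/
def cosFun (n : ℕ) : X := ‖ofCont (cosC n)‖⁻¹ • ofCont (cosC n)

theorem orthonormal_cosFun : Orthonormal ℝ cosFun := by
  refine ⟨fun n => ?_, fun m n hmn => ?_⟩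
  · rw [cosFun, norm_smul, norm_inv, norm_norm,
      inv_mul_cancel₀ (norm_ne_zero_iff.2 (ofCont_cosC_ne_zero n))]
  · simp only [cosFun]
    rw [inner_smul_left, inner_smul_right, inner_cosC,
      integral_cos _ (by omega), integral_cos _ (by omega)]
    simp

theorem norm_ofCont_le {f : C(ℝ, ℝ)} {ε : ℝ} (hε : 0 ≤ ε) (h : ∀ x ∈ Icc (0 : ℝ) 1, |f x| ≤ ε) :
    ‖ofCont f‖ ≤ ε := by
  have h1 : ‖ofCont f‖ ≤
      (volume.restrict (Ioo (0 : ℝ) 1) univ).toNNReal ^ ((2 : ENNReal).toReal)⁻¹ * ε := by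
    refine Lp.norm_le_of_ae_bound hε ?_
    filter_upwards [ofCont_ae f, ae_Ioo] with x hx hx'
    rw [hx]
    exact h x (Ioo_subset_Icc_self hx')
  simpa using h1

/-- The product formula for `cos (π x) cos (n π x)` lowers the power by one and shifts the frequency
by `±1`. Integer frequencies avoid a special case at `n = 0`. -/
theorem orthogonal_cos_pow {w : X} (hw : ∀ n : ℤ, inner ℝ w (ofCont (cosC n)) = 0) (k : ℕ) :
    ∀ n : ℤ, inner ℝ w (ofCont (cosC 1 ^ k * cosC n)) = 0 := by
  induction k with
  | zero => intro n; simpa using hw n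
  | succ k ih =>
    intro n
    have h : cosC 1 ^ (k + 1) * cosC n = (2⁻¹ : ℝ) • (cosC 1 ^ k * cosC (n + 1)) +
        (2⁻¹ : ℝ) • (cosC 1 ^ k * cosC (n - 1)) := by
      ext x
      simp only [cosC, ContinuousMap.mul_apply, ContinuousMap.pow_apply, ContinuousMap.add_apply,
        ContinuousMap.smul_apply, ContinuousMap.coe_mk, Int.cast_sub, Int.cast_add, sub_mul,
        add_mul, Real.cos_sub, Real.cos_add, smul_eq_mul]
      ring
    have h' : ofCont (cosC 1 ^ (k + 1) * cosC n) = (2⁻¹ : ℝ) • ofCont (cosC 1 ^ k * cosC (n + 1)) +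
        (2⁻¹ : ℝ) • ofCont (cosC 1 ^ k * cosC (n - 1)) := by
      rw [h]; rfl
    rw [h', inner_add_right, inner_smul_right, inner_smul_right, ih, ih]
    simp

theorem orthogonal_poly_cos {w : X} (hw : ∀ n : ℤ, inner ℝ w (ofCont (cosC n)) = 0)
    (p : Polynomial ℝ) : inner ℝ w (ofCont ((polyC p).comp (cosC 1))) = 0 := by
  induction p using Polynomial.induction_on' with
  | add p q hp hq =>
    have : ofCont ((polyC (p + q)).comp (cosC 1)) =
        ofCont ((polyC p).comp (cosC 1)) + ofCont ((polyC q).comp (cosC 1)) := by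
      refine congrArg ofCont (a₂ := (polyC p).comp (cosC 1) + (polyC q).comp (cosC 1)) ?_
      ext x
      simp [polyC]
    rw [this, inner_add_right, hp, hq, add_zero]
  | monomial k a =>
    have : ofCont ((polyC (Polynomial.monomial k a)).comp (cosC 1)) =
        a • ofCont (cosC 1 ^ k * cosC 0) := by
      refine congrArg ofCont (a₂ := a • (cosC 1 ^ k * cosC 0)) ?_
      ext x
      simp [polyC, cosC]
    rw [this, inner_smul_right, orthogonal_cos_pow hw, mul_zero]

/-- The substitution `s = cos (π x)` maps `[0,1]` homeomorphically onto `[-1,1]`, so Weierstrass'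
theorem approximates `f` uniformly by polynomials in `cos (π x)`, to which `w` is orthogonal. -/
theorem orthogonal_ofCont {w : X} (hw : ∀ n : ℤ, inner ℝ w (ofCont (cosC n)) = 0) (f : C(ℝ, ℝ)) :
    inner ℝ w (ofCont f) = 0 := by
  by_contra hne
  have hpos : 0 < |inner ℝ w (ofCont f)| := abs_pos.2 hne
  -- With this tolerance, `‖w‖ * ε` is strictly smaller than `|⟪w, f⟫|`, which contradicts the
  -- estimate `h3`.
  set ε : ℝ := |inner ℝ w (ofCont f)| / (‖w‖ + 1) with hε
  have hw1 : 0 < ‖w‖ + 1 := by positivity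
  have hε0 : 0 < ε := by positivity
  obtain ⟨p, hp⟩ := exists_polynomial_near_of_continuousOn (-1) 1
    (fun s => f (Real.arccos s / Real.pi))
    (by fun_prop) ε hε0
  have h1 : ‖ofCont (f - (polyC p).comp (cosC 1))‖ ≤ ε := by
    refine norm_ofCont_le hε0.le fun x hx => ?_
    have h2 := hp (Real.cos (Real.pi * x)) ⟨Real.neg_one_le_cos _, Real.cos_le_one _⟩
    rw [Real.arccos_cos (mul_nonneg Real.pi_pos.le hx.1)
      (mul_le_of_le_one_right Real.pi_pos.le hx.2), mul_div_cancel_left₀ _ Real.pi_ne_zero,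
      abs_sub_comm] at h2
    simpa [polyC, cosC] using h2.le
  have h2 : inner ℝ w (ofCont f) = inner ℝ w (ofCont (f - (polyC p).comp (cosC 1))) := by
    rw [show ofCont (f - (polyC p).comp (cosC 1)) =
      ofCont f - ofCont ((polyC p).comp (cosC 1)) from rfl, inner_sub_right,
      orthogonal_poly_cos hw, sub_zero]
  have h3 : |inner ℝ w (ofCont f)| ≤ ‖w‖ * ε := by
    rw [h2]
    exact (abs_real_inner_le_norm _ _).trans (mul_le_mul_of_nonneg_left h1 (norm_nonneg w))
  have h4 : ε * (‖w‖ + 1) = |inner ℝ w (ofCont f)| := div_mul_cancel₀ _ hw1.ne'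
  nlinarith

theorem dense_ofCont : Dense (range ofCont) := by
  refine (Lp.dense_hasCompactSupport_contDiff (F := ℝ) (p := 2)
    (μ := volume.restrict (Ioo (0 : ℝ) 1)) ENNReal.ofNat_ne_top).mono ?_
  rintro f ⟨g, hfg, -, hg⟩
  exact ⟨⟨g, hg.continuous⟩, Lp.ext ((ofCont_ae _).trans hfg.symm)⟩

theorem eq_zero_of_orthogonal_cosC {w : X} (hw : ∀ n : ℕ, inner ℝ w (ofCont (cosC n)) = 0) :
    w = 0 := by
  have hw' : ∀ n : ℤ, inner ℝ w (ofCont (cosC n)) = 0 := by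
    intro n
    rcases Int.natAbs_eq n with h | h
    · rw [h]; exact hw _
    · have : cosC n = cosC (n.natAbs : ℤ) := by
        ext x
        rw [h]
        simp [cosC]
      rw [this]
      exact hw _
  refine dense_ofCont.eq_zero_of_inner_right (𝕜 := ℝ) ?_
  rintro _ ⟨f, rfl⟩
  rw [real_inner_comm]
  exact orthogonal_ofCont hw' f

theorem inner_cosFun (n : ℕ) (w : X) :
    inner ℝ (cosFun n) w = ‖ofCont (cosC n)‖⁻¹ * inner ℝ w (ofCont (cosC n)) := by
  rw [cosFun, inner_smul_left, real_inner_comm]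
  simp

/-- The Hilbert basis of `L²(0,1)` that consists of the normalized cosine functions. -/
def cosBasis : HilbertBasis ℕ ℝ X :=
  HilbertBasis.mkOfOrthogonalEqBot orthonormal_cosFun <| by
    rw [Submodule.eq_bot_iff]
    intro w hw
    refine eq_zero_of_orthogonal_cosC fun n => ?_
    have h := (Submodule.mem_orthogonal _ _).1 hw (cosFun n) (Submodule.subset_span ⟨n, rfl⟩)
    rw [inner_cosFun] at h
    exact (mul_eq_zero.1 h).resolve_left
      (inv_ne_zero (norm_ne_zero_iff.2 (ofCont_cosC_ne_zero n)))

/-- The `n`-th Fourier cosine coefficient. -/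
def coef (n : ℕ) : X →L[ℝ] ℝ := innerSL ℝ (cosFun n)

theorem coef_apply (n : ℕ) (w : X) :
    coef n w = ‖ofCont (cosC n)‖⁻¹ * inner ℝ w (ofCont (cosC n)) := inner_cosFun n w

theorem cosBasis_repr (w : X) (n : ℕ) : cosBasis.repr w n = coef n w := by
  rw [HilbertBasis.repr_apply_apply, cosBasis, HilbertBasis.coe_mkOfOrthogonalEqBot]
  rfl

theorem ext_coef {w z : X} (h : ∀ n, coef n w = coef n z) : w = z := by
  apply cosBasis.repr.injective
  ext n
  rw [cosBasis_repr, cosBasis_repr, h]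

/-! ### The Neumann Laplacian in the cosine basis -/

/-- The eigenvalues of `-Δ`. -/
def eigen (n : ℕ) : ℝ := (n * Real.pi) ^ 2

theorem mem_graph_neumann {w g : X} : (w, g) ∈ neumannLaplacian.graph ↔
    ∃ h : w ∈ H2, dx ⟨w, h⟩ 0 = 0 ∧ dx ⟨w, h⟩ 1 = 0 ∧ dxx ⟨w, h⟩ = g := by
  rw [LinearPMap.mem_graph_iff]
  constructor
  · rintro ⟨⟨w, h, h0, h1⟩, rfl, rfl⟩
    exact ⟨h, h0, h1, rfl⟩
  · rintro ⟨h, h0, h1, rfl⟩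
    exact ⟨⟨w, h, h0, h1⟩, rfl, rfl⟩

/-- In Green's formula with `cos (n π x)` all boundary terms vanish: those with `w'` by the Neumann
conditions, those with `w` because `sin (n π x)` is zero at both ends. -/
theorem coef_dxx {w : H2} (h0 : dx w 0 = 0) (h1 : dx w 1 = 0) (n : ℕ) :
    coef n (dxx w) = -eigen n * coef n (w : X) := by
  have h := green w (cosC n) ⟨fun x => -(n * Real.pi) * Real.sin (n * Real.pi * x), by fun_prop⟩
    ((-eigen n) • cosC n)
    (fun x => by
      convert! ((hasDerivAt_id x).const_mul (n * Real.pi)).cos using 1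
      simp
      ring)
    (fun x => by
      convert! (((hasDerivAt_id x).const_mul (n * Real.pi)).sin).const_mul (-(n * Real.pi)) using 1
      simp [cosC, eigen]
      ring)
  rw [h0, h1, show ofCont (-eigen n • cosC n) = -eigen n • ofCont (cosC n) from rfl,
    inner_smul_right] at h
  rw [coef_apply, coef_apply, h]
  simp only [ContinuousMap.coe_mk, mul_one, Real.sin_nat_mul_pi, mul_zero, Real.sin_zero]
  ring

/-- The witness is the constant function `1`, the kernel of the Neumann Laplacian. Its zeroth
coefficient is nonzero, since otherwise all its coefficients would vanish. -/
theorem exists_const_h2 : ∃ k : H2, dx k 0 = 0 ∧ dx k 1 = 0 ∧ dxx k = 0 ∧ coef 0 (k : X) ≠ 0 ∧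
    ∀ n, n ≠ 0 → coef n (k : X) = 0 := by
  obtain ⟨k, hk, hk0, hk1, hk2⟩ := exists_h2 1 0 0
  have hk1' : dx k 1 = 0 := by
    rw [hk1, zero_add, intervalIntegral_congr_ae_Ioo (Lp.coeFn_zero ℝ 2 _)]
    simp
  have hn : ∀ n, n ≠ 0 → coef n (k : X) = 0 := by
    intro n hn
    have h := coef_dxx hk0 hk1' n
    rw [hk2, map_zero, eq_comm, mul_eq_zero, neg_eq_zero] at h
    refine h.resolve_left (pow_ne_zero 2 (mul_ne_zero (by exact_mod_cast hn) Real.pi_ne_zero))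
  refine ⟨k, hk0, hk1', hk2, fun h0 => ?_, hn⟩
  have h : k = 0 := by
    refine Subtype.ext (ext_coef fun n => ?_)
    by_cases h : n = 0
    · rw [h, h0]; simp
    · rw [hn n h]; simp
  have h' : val k 0 = 0 := by
    rw [h]
    exact map_zero (valₗ (left_mem_Icc.2 zero_le_one))
  rw [hk] at h'
  exact one_ne_zero h'

/-- For the converse, integrate `g` twice to get `z`. The case `n = 0` of the relation says that `g`
has mean zero, which is the condition `z'(1) = 0`. For `n ≠ 0` the coefficients of `z` and `w` agree
because the eigenvalue is nonzero, so `w` differs from `z` by a constant. -/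
theorem mem_graph_neumann_iff_coef {w g : X} : (w, g) ∈ neumannLaplacian.graph ↔
    ∀ n, coef n g = -eigen n * coef n w := by
  constructor
  · intro h
    obtain ⟨h, h0, h1, rfl⟩ := mem_graph_neumann.1 h
    exact coef_dxx h0 h1
  · intro h
    obtain ⟨z, -, hz0, hz1, hz2⟩ := exists_h2 0 0 g
    have hz1' : dx z 1 = 0 := by
      have h3 := h 0
      rw [coef_apply, eigen] at h3
      simp only [Nat.cast_zero, zero_mul, ne_eq, OfNat.ofNat_ne_zero, not_false_eq_true, zero_pow,
        neg_zero, mul_eq_zero, inv_eq_zero, norm_eq_zero] at h3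
      have h4 := h3.resolve_left (ofCont_cosC_ne_zero _)
      rw [inner_ofCont] at h4
      rw [hz1, zero_add]
      simpa [cosC] using h4
    obtain ⟨k, hk0, hk1, hk2, hk, hkn⟩ := exists_const_h2
    have hG : (((z : X), g) : X × X) ∈ neumannLaplacian.graph :=
      mem_graph_neumann.2 ⟨z.2, hz0, hz1', hz2⟩
    have hK : (((k : X), 0) : X × X) ∈ neumannLaplacian.graph :=
      mem_graph_neumann.2 ⟨k.2, hk0, hk1, hk2⟩
    have hw : w = z + (coef 0 (w - z) / coef 0 (k : X)) • (k : X) := by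
      refine ext_coef fun n => ?_
      by_cases hn : n = 0
      · subst hn
        rw [map_add, map_smul, smul_eq_mul, div_mul_cancel₀ _ hk, map_sub]
        ring
      · rw [map_add, map_smul, hkn n hn, smul_zero, add_zero]
        have h5 := h n
        rw [← hz2, coef_dxx hz0 hz1' n] at h5
        exact (mul_left_cancel₀ (neg_ne_zero.2
          (pow_ne_zero 2 (mul_ne_zero (by exact_mod_cast hn) Real.pi_ne_zero))) h5).symm
    have := neumannLaplacian.graph.add_mem hG
      (neumannLaplacian.graph.smul_mem (coef 0 (w - z) / coef 0 (k : X)) hK)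
    rw [Prod.smul_mk, smul_zero, Prod.mk_add_mk, add_zero, ← hw] at this
    exact this

/-! ### Operators that are diagonal in the cosine basis -/

theorem exists_diag {m : ℕ → ℝ} {C : ℝ} (hm : ∀ n, |m n| ≤ C) :
    ∃ D : X →L[ℝ] X, (∀ x, ‖D x‖ ≤ C * ‖x‖) ∧ ∀ n x, coef n (D x) = m n * coef n x := by
  have hB : ∀ n, ‖m n • ContinuousLinearMap.id ℝ ℝ‖ ≤ C := fun n => by
    rw [norm_smul, ContinuousLinearMap.norm_id, mul_one]
    exact hm n
  have hC : 0 ≤ C := (abs_nonneg _).trans (hm 0)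
  refine ⟨(cosBasis.repr.symm : lp (fun _ : ℕ => ℝ) 2 →L[ℝ] X).comp
    ((lp.mapCLM 2 (fun n => m n • ContinuousLinearMap.id ℝ ℝ) hC hB).comp
      (cosBasis.repr : X →L[ℝ] lp (fun _ : ℕ => ℝ) 2)), fun x => ?_, fun n x => ?_⟩
  · simp only [ContinuousLinearMap.comp_apply]
    refine (cosBasis.repr.symm.norm_map _).trans_le ?_
    refine ((lp.mapCLM 2 _ hC hB).le_opNorm _).trans ?_
    refine (mul_le_mul_of_nonneg_right (lp.norm_mapCLM_le 2 _ hC hB) (norm_nonneg _)).trans_eq ?_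
    congr 1
    exact cosBasis.repr.norm_map x
  · rw [← cosBasis_repr, ← cosBasis_repr]
    simp

theorem coef_cosFun_of_ne {m n : ℕ} (h : m ≠ n) : coef m (cosFun n) = 0 :=
  orthonormal_cosFun.2 h

theorem hasSum_coef (x : X) : HasSum (fun n => coef n x • cosFun n) x := by
  have h := cosBasis.hasSum_repr x
  simp only [cosBasis_repr] at h
  convert! h using 3
  simp [cosBasis]

/-- The semigroup with the coefficients `exp (μ n t)`, for `μ` bounded above. -/
theorem exists_diag_semigroup {μ : ℕ → ℝ} {M : ℝ} (hμ : ∀ n, μ n ≤ M) :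
    ∃ S : ℝ → X →L[ℝ] X, (∀ t, 0 ≤ t → ∀ n x, coef n (S t x) = Real.exp (μ n * t) * coef n x) ∧
      Continuous fun p : ℝ × X => S p.1 p.2 := by
  -- Time is cut off at `0`, so that `S` is bounded and continuous on all of `ℝ`; `|M|` makes the
  -- bound increase with time.
  have hb : ∀ t n, |Real.exp (μ n * max t 0)| ≤ Real.exp (|M| * max t 0) := fun t n => by
    rw [Real.abs_exp]
    exact Real.exp_le_exp.2 (mul_le_mul_of_nonneg_right ((hμ n).trans (le_abs_self M))
      (le_max_right _ _))
  choose S hS1 hS2 using fun t => exists_diag (hb t)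
  have hS3 : ∀ t n, S t (cosFun n) = Real.exp (μ n * max t 0) • cosFun n := by
    refine fun t n => ext_coef fun k => ?_
    rw [hS2, map_smul, smul_eq_mul]
    by_cases hk : k = n
    · rw [hk]
    · rw [coef_cosFun_of_ne hk]; simp
  have hcont : ∀ x, Continuous fun t => S t x := by
    refine fun x => continuous_iff_continuousAt.2 fun t₀ => ?_
    -- On a finite partial sum of the cosine expansion, `S t` is an explicit continuous function of
    -- `t`. The operators are uniformly bounded for `t < t₀ + 1`, so the tail of the expansion is
    -- uniformly small there.
    refine continuousAt_of_locally_uniform_approx_of_continuousAt fun u hu => ?_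
    obtain ⟨ε, hε, hεu⟩ := Metric.mem_uniformity_dist.1 hu
    set B := Real.exp (|M| * max (t₀ + 1) 0) with hB
    have hBpos : 0 < B := Real.exp_pos _
    obtain ⟨s, hs⟩ := ((Metric.tendsto_nhds.1 (hasSum_coef x)) (ε / B) (by positivity)).exists
    refine ⟨Iio (t₀ + 1), Iio_mem_nhds (by linarith),
      fun t => S t (∑ n ∈ s, coef n x • cosFun n), ?_, fun t ht => hεu ?_⟩
    · simp only [map_sum, map_smul, hS3]
      fun_prop
    · rw [dist_eq_norm, ← map_sub]
      refine (hS1 t _).trans_lt ?_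
      have h1 : Real.exp (|M| * max t 0) ≤ B := Real.exp_le_exp.2
        (mul_le_mul_of_nonneg_left (max_le_max_right _ (le_of_lt ht)) (abs_nonneg M))
      rw [dist_comm, dist_eq_norm] at hs
      calc _ ≤ B * ‖x - ∑ n ∈ s, coef n x • cosFun n‖ :=
            mul_le_mul_of_nonneg_right h1 (norm_nonneg _)
        _ < B * (ε / B) := mul_lt_mul_of_pos_left hs hBpos
        _ = ε := mul_div_cancel₀ _ hBpos.ne'
  refine ⟨S, fun t ht n x => by rw [hS2, max_eq_left ht], ?_⟩
  refine continuous_iff_continuousAt.2 fun ⟨t₀, x₀⟩ => ?_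
  rw [ContinuousAt, tendsto_iff_norm_sub_tendsto_zero]
  have h1 : Tendsto (fun p : ℝ × X => Real.exp (|M| * max p.1 0) * ‖p.2 - x₀‖ +
      ‖S p.1 x₀ - S t₀ x₀‖) (𝓝 (t₀, x₀)) (𝓝 0) := by
    have h2 : Continuous fun p : ℝ × X => Real.exp (|M| * max p.1 0) * ‖p.2 - x₀‖ +
      ‖S p.1 x₀ - S t₀ x₀‖ := by
      have := (hcont x₀).comp (continuous_fst (X := ℝ) (Y := X))
      simp only [Function.comp_def] at this
      fun_prop
    simpa using h2.tendsto (t₀, x₀)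
  refine squeeze_zero (fun _ => norm_nonneg _) (fun p => ?_) h1
  calc ‖S p.1 p.2 - S t₀ x₀‖ = ‖S p.1 (p.2 - x₀) + (S p.1 x₀ - S t₀ x₀)‖ := by
        rw [map_sub]; congr 1; abel
    _ ≤ _ := (norm_add_le _ _).trans (add_le_add_left (hS1 _ _) _)

/-- A semigroup with the coefficients `exp (μ n t)` is generated by the operator with the
coefficients `μ n`. -/
theorem generates_of_coef {μ : ℕ → ℝ} {M : ℝ} (hμ : ∀ n, μ n ≤ M) {A : X →ₗ.[ℝ] X}
    (hA : ∀ x y, (x, y) ∈ A.graph ↔ ∀ n, coef n y = μ n * coef n x) :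
    GeneratesC0Semigroup A := by
  obtain ⟨S, hS, hSc⟩ := exists_diag_semigroup hμ
  have hS0 : ∀ x, S 0 x = x := fun x => ext_coef fun n => by simp [hS 0 le_rfl]
  have hSx : ∀ x, Continuous fun t => S t x := fun x =>
    hSc.comp (continuous_id.prodMk continuous_const)
  refine ⟨fun t => S t, ⟨?_, fun s t => ?_, fun x => ?_⟩, fun x y => ?_⟩
  · ext1 x
    exact hS0 x
  · refine ContinuousLinearMap.ext fun x => ext_coef fun n => ?_
    rw [ContinuousLinearMap.comp_apply, hS _ (NNReal.coe_nonneg _), hS _ (NNReal.coe_nonneg _),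
      hS _ (NNReal.coe_nonneg _), NNReal.coe_add, mul_add, Real.exp_add, mul_assoc]
  · have h := ((hSx x).comp NNReal.continuous_coe).tendsto 0
    simp only [Function.comp_def, NNReal.coe_zero, hS0] at h
    exact h.mono_left nhdsWithin_le_nhds
  · have hcoe : Tendsto (fun t : ℝ≥0 => (t : ℝ)) (𝓝[>] 0) (𝓝[≠] 0) := by
      refine tendsto_nhdsWithin_iff.2 ⟨?_, ?_⟩
      · exact (NNReal.continuous_coe.tendsto' 0 0 rfl).mono_left nhdsWithin_le_nhds
      · filter_upwards [self_mem_nhdsWithin] with t ht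
        exact (NNReal.coe_pos.2 ht).ne'
    rw [hA]
    constructor
    · intro h
      -- The difference quotient is the mean of `S s y` over `[0, t]`: the identity `S t x - x = ∫ S
      -- s y` holds coefficient by coefficient.
      have hd : HasDerivAt (fun t => ∫ s in (0 : ℝ)..t, S s y) y 0 := by
        have := (hSx y).integral_hasStrictDerivAt 0 0
        rw [hS0] at this
        exact this.hasDerivAt
      rw [hasDerivAt_iff_tendsto_slope_zero] at hd
      refine (hd.comp hcoe).congr fun t => ?_
      simp only [Function.comp_apply, zero_add, intervalIntegral.integral_same, sub_zero]
      congr 1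
      refine ext_coef fun n => ?_
      rw [← ContinuousLinearMap.intervalIntegral_comp_comm _ ((hSx y).intervalIntegrable _ _),
        map_sub, hS _ t.coe_nonneg]
      have hF : ∀ s : ℝ, HasDerivAt (fun s => Real.exp (μ n * s) * coef n x)
          (Real.exp (μ n * s) * coef n y) s := fun s => by
        have h1 := (((hasDerivAt_id s).const_mul (μ n)).exp).mul_const (coef n x)
        convert! h1 using 1
        rw [h n]
        simp
        ring
      have hI : ∫ s in (0 : ℝ)..t, coef n (S s y) =
          ∫ s in (0 : ℝ)..t, Real.exp (μ n * s) * coef n y := by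
        refine intervalIntegral.integral_congr fun s hs => ?_
        rw [uIcc_of_le t.coe_nonneg] at hs
        exact hS s hs.1 n y
      rw [hI, intervalIntegral.integral_eq_sub_of_hasDerivAt (fun s _ => hF s)
        (Continuous.intervalIntegrable (by fun_prop) _ _)]
      simp
    · intro h n
      -- Conversely, norm convergence of the quotients gives convergence of each coefficient, and
      -- the limit is the derivative of `exp (μ n s)` at `0` times the coefficient of `x`.
      have h1 := ((coef n).continuous.tendsto y).comp h
      have h2 : HasDerivAt (fun s => Real.exp (μ n * s) * coef n x) (μ n * coef n x) 0 := by
        have h1 := (((hasDerivAt_id (0 : ℝ)).const_mul (μ n)).exp).mul_const (coef n x)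
        convert! h1 using 1
        simp
      rw [hasDerivAt_iff_tendsto_slope_zero] at h2
      refine tendsto_nhds_unique h1 ((h2.comp hcoe).congr fun t => ?_)
      simp only [Function.comp_apply, map_smul, map_sub, hS _ t.coe_nonneg, zero_add, mul_zero,
        Real.exp_zero, one_mul]

/-! ### The elliptic operator and the operator `A` -/

variable {γ : ℝ}

theorem gamma_add_eigen_ne_zero (hγ : ∀ n : ℕ, γ ≠ -((n : ℝ) * Real.pi) ^ 2) (n : ℕ) :
    γ + eigen n ≠ 0 := fun h => hγ n (eq_neg_of_add_eq_zero_left h)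

theorem tendsto_eigen : Tendsto eigen atTop atTop := by
  refine (tendsto_pow_atTop two_ne_zero).comp ?_
  exact tendsto_natCast_atTop_atTop.atTop_mul_const Real.pi_pos

/-- The inverses tend to `0`, hence are bounded. No condition on `γ` is needed because `0⁻¹ = 0`;
the non-resonance condition enters only when the multiplier is identified with the inverse of `γI -
Δ`. -/
theorem exists_resolvent_bound (γ : ℝ) : ∃ C, ∀ n, |(γ + eigen n)⁻¹| ≤ C := by
  have h : Tendsto (fun n => (γ + eigen n)⁻¹) atTop (𝓝 0) :=
    tendsto_inv_atTop_zero.comp (tendsto_atTop_add_const_left _ γ tendsto_eigen)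
  obtain ⟨C, hC⟩ := (Metric.isBounded_range_of_tendsto _ h).exists_norm_le
  exact ⟨C, fun n => hC _ ⟨n, rfl⟩⟩

/-- The operator with the coefficients `1 / (γ + (n π)²)`. -/
def resolvent (γ : ℝ) : X →L[ℝ] X := (exists_diag (exists_resolvent_bound γ).choose_spec).choose

theorem coef_resolvent (γ : ℝ) (n : ℕ) (x : X) :
    coef n (resolvent γ x) = (γ + eigen n)⁻¹ * coef n x :=
  (exists_diag (exists_resolvent_bound γ).choose_spec).choose_spec.2 n x

theorem ellipticOp_apply (x : (ellipticOp γ).domain) (y : neumannLaplacian.domain)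
    (h : (x : X) = y) : ellipticOp γ x = γ • (x : X) - neumannLaplacian y := by
  obtain ⟨x, hx⟩ := x
  obtain ⟨y, hy⟩ := y
  obtain rfl : x = y := h
  rw [sub_eq_add_neg]
  rfl

theorem coef_neumann (x : neumannLaplacian.domain) (n : ℕ) :
    coef n (neumannLaplacian x) = -eigen n * coef n (x : X) :=
  mem_graph_neumann_iff_coef.1 (neumannLaplacian.mem_graph x) n

theorem coef_ellipticOp (x : (ellipticOp γ).domain) (n : ℕ) :
    coef n (ellipticOp γ x) = (γ + eigen n) * coef n (x : X) := by
  rw [ellipticOp_apply x ⟨x, x.2⟩ rfl, map_sub, coef_neumann, map_smul, smul_eq_mul]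
  ring

theorem resolvent_mem_graph (hγ : ∀ n : ℕ, γ ≠ -((n : ℝ) * Real.pi) ^ 2) (f : X) :
    (resolvent γ f, γ • resolvent γ f - f) ∈ neumannLaplacian.graph := by
  refine mem_graph_neumann_iff_coef.2 fun n => ?_
  have := gamma_add_eigen_ne_zero hγ n
  rw [map_sub, map_smul, coef_resolvent, smul_eq_mul]
  field_simp
  ring

theorem exists_resolvent_mem (hγ : ∀ n : ℕ, γ ≠ -((n : ℝ) * Real.pi) ^ 2) (f : X) :
    ∃ h : resolvent γ f ∈ (ellipticOp γ).domain, ellipticOp γ ⟨resolvent γ f, h⟩ = f := by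
  have hD : resolvent γ f ∈ neumannLaplacian.domain :=
    LinearPMap.mem_domain_of_mem_graph (resolvent_mem_graph hγ f)
  refine ⟨hD, ext_coef fun n => ?_⟩
  rw [coef_ellipticOp, coef_resolvent, mul_inv_cancel_left₀ (gamma_add_eigen_ne_zero hγ n)]

theorem injective_ellipticOp (hγ : ∀ n : ℕ, γ ≠ -((n : ℝ) * Real.pi) ^ 2) :
    Function.Injective (ellipticOp γ) := fun x y h => by
  refine Subtype.ext (ext_coef fun n => ?_)
  have h1 := congrArg (coef n) h
  rw [coef_ellipticOp, coef_ellipticOp] at h1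
  exact mul_left_cancel₀ (gamma_add_eigen_ne_zero hγ n) h1

theorem bijective_ellipticOp (hγ : ∀ n : ℕ, γ ≠ -((n : ℝ) * Real.pi) ^ 2) :
    Function.Bijective (ellipticOp γ) :=
  ⟨injective_ellipticOp hγ, fun f => ⟨_, (exists_resolvent_mem hγ f).choose_spec⟩⟩

theorem inverse_ellipticOp_domain (hγ : ∀ n : ℕ, γ ≠ -((n : ℝ) * Real.pi) ^ 2) :
    (ellipticOp γ).inverse.domain = ⊤ := by
  rw [LinearPMap.inverse_domain]
  exact LinearMap.range_eq_top.2 (bijective_ellipticOp hγ).2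

theorem inverse_ellipticOp_apply (hγ : ∀ n : ℕ, γ ≠ -((n : ℝ) * Real.pi) ^ 2)
    (x : (ellipticOp γ).inverse.domain) : (ellipticOp γ).inverse x = resolvent γ x := by
  obtain ⟨h, hx⟩ := exists_resolvent_mem hγ x
  exact LinearPMap.inverse_apply_eq (LinearMap.ker_eq_bot.2 (injective_ellipticOp hγ)) hx

theorem opA_domain (ρ α β : ℝ) (hγ : ∀ n : ℕ, γ ≠ -((n : ℝ) * Real.pi) ^ 2) :
    (opA ρ α β γ).domain = neumannLaplacian.domain := by
  change neumannLaplacian.domain ⊓ (ellipticOp γ).inverse.domain = _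
  rw [inverse_ellipticOp_domain hγ, inf_top_eq]

/-- The eigenvalues of `A`. -/
def eigenA (ρ α β γ : ℝ) (n : ℕ) : ℝ := -eigen n - ρ + α * β * (γ + eigen n)⁻¹

/-- `A` is a bounded perturbation of the Laplacian: given the coefficient relation, solving for the
Laplacian term puts `x` in the Neumann domain. -/
theorem mem_graph_opA (ρ α β : ℝ) (hγ : ∀ n : ℕ, γ ≠ -((n : ℝ) * Real.pi) ^ 2) (x y : X) :
    (x, y) ∈ (opA ρ α β γ).graph ↔ ∀ n, coef n y = eigenA ρ α β γ n * coef n x := by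
  have happ : ∀ z : (opA ρ α β γ).domain, ∀ n,
      coef n (opA ρ α β γ z) = eigenA ρ α β γ n * coef n (z : X) := by
    intro z n
    have h1 : opA ρ α β γ z = (-ρ) • (z : X) + (neumannLaplacian ⟨z, z.2.1⟩ +
      (α * β) • (ellipticOp γ).inverse ⟨z, z.2.2⟩) := rfl
    rw [h1, inverse_ellipticOp_apply hγ, map_add, map_add, map_smul, map_smul, coef_neumann,
      coef_resolvent, eigenA, smul_eq_mul, smul_eq_mul]
    ring
  constructor
  · intro h
    obtain ⟨z, rfl, rfl⟩ := LinearPMap.mem_graph_iff _ |>.1 h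
    exact happ z
  · intro h
    have hG : (x, y + ρ • x - (α * β) • resolvent γ x) ∈ neumannLaplacian.graph := by
      refine mem_graph_neumann_iff_coef.2 fun n => ?_
      rw [map_sub, map_add, map_smul, map_smul, h, coef_resolvent, eigenA, smul_eq_mul,
        smul_eq_mul]
      ring
    have hx : x ∈ (opA ρ α β γ).domain := by
      rw [opA_domain ρ α β hγ]
      exact LinearPMap.mem_domain_of_mem_graph hG
    refine LinearPMap.mem_graph_iff _ |>.2 ⟨⟨x, hx⟩, rfl, ext_coef fun n => ?_⟩
    rw [happ, h]

theorem exists_eigenA_le (ρ α β γ : ℝ) : ∃ M, ∀ n, eigenA ρ α β γ n ≤ M := by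
  obtain ⟨C, hC⟩ := exists_resolvent_bound γ
  refine ⟨-ρ + |α * β| * C, fun n => ?_⟩
  have h1 : α * β * (γ + eigen n)⁻¹ ≤ |α * β| * C := by
    refine (le_abs_self _).trans ?_
    rw [abs_mul]
    exact mul_le_mul_of_nonneg_left (hC n) (abs_nonneg _)
  have h2 : 0 ≤ eigen n := sq_nonneg _
  rw [eigenA]
  linarith

theorem generatesC0Semigroup_opA (ρ α β : ℝ) (hγ : ∀ n : ℕ, γ ≠ -((n : ℝ) * Real.pi) ^ 2) :
    GeneratesC0Semigroup (opA ρ α β γ) := by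
  obtain ⟨M, hM⟩ := exists_eigenA_le ρ α β γ
  exact generates_of_coef hM (mem_graph_opA ρ α β hγ)

/-! ### Existence of classical solutions -/

/-- For `f ∈ C¹` and `z₀` in the domain, the inhomogeneous problem `z' = A z + f`, `z 0 = z₀` for an
operator `A` that is diagonal in the cosine basis has a strict solution. -/
theorem exists_strict_solution {μ : ℕ → ℝ} {M : ℝ} (hμ : ∀ n, μ n ≤ M) {z₀ a : X}
    (ha : ∀ n, coef n a = μ n * coef n z₀) {f F : ℝ → X}
    (hf : ∀ t ∈ Ici (0 : ℝ), HasDerivWithinAt f (F t) (Ici 0) t) (hF : ContinuousOn F (Ici 0)) :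
    ∃ z q : ℝ → X, Continuous q ∧ z 0 = z₀ ∧ (∀ t, HasDerivAt z (q t) t) ∧
      ∀ t ∈ Ici (0 : ℝ), ∀ n, coef n (q t - f t) = μ n * coef n (z t) := by
  obtain ⟨S, hS, hSc⟩ := exists_diag_semigroup hμ
  -- Freezing `f'` at negative times makes the integrand below continuous on the whole line.
  set G : ℝ → X := fun s => F (max s 0) with hG
  have hGc : Continuous G :=
    hF.comp_continuous (continuous_id.max continuous_const) fun s => mem_Ici.2 (le_max_right _ _)
  have hI : Continuous fun p : ℝ × ℝ => S (p.1 - p.2) (G p.2) :=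
    hSc.comp ((continuous_fst.sub continuous_snd).prodMk (hGc.comp continuous_snd))
  -- This is the formal derivative of the variation of constants formula, with the derivative moved
  -- onto `f`. Taking `z` as its primitive makes `z` automatically `C¹`, and only the equation
  -- remains to be checked.
  set q : ℝ → X := fun t => S t (a + f 0) + ∫ s in (0 : ℝ)..t, S (t - s) (G s) with hq
  have hqc : Continuous q := by
    refine (hSc.comp (continuous_id.prodMk continuous_const)).add ?_
    exact intervalIntegral.continuous_parametric_intervalIntegral_of_continuous
      (f := fun t s => S (t - s) (G s)) hI continuous_id
  set z : ℝ → X := fun t => z₀ + ∫ s in (0 : ℝ)..t, q s with hz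
  have hzd : ∀ t, HasDerivAt z (q t) t := fun t =>
    ((hqc.integral_hasStrictDerivAt 0 t).hasDerivAt).const_add z₀
  have hz0 : z 0 = z₀ := by simp [hz]
  refine ⟨z, q, hqc, hz0, hzd, fun t ht n => ?_⟩
  have hGn : Continuous fun s => coef n (G s) := (coef n).continuous.comp hGc
  set Q : ℝ → ℝ := fun t => Real.exp (μ n * t) *
    (coef n (a + f 0) + ∫ s in (0 : ℝ)..t, Real.exp (-(μ n * s)) * coef n (G s)) with hQ
  have hqQ : ∀ t, 0 ≤ t → coef n (q t) = Q t := by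
    intro t ht
    have h1 : coef n (∫ s in (0 : ℝ)..t, S (t - s) (G s)) =
        ∫ s in (0 : ℝ)..t, Real.exp (μ n * t) * (Real.exp (-(μ n * s)) * coef n (G s)) := by
      have hIt : Continuous fun s => S (t - s) (G s) :=
        hI.comp (continuous_const.prodMk continuous_id)
      rw [← ContinuousLinearMap.intervalIntegral_comp_comm _ (hIt.intervalIntegrable _ _)]
      refine intervalIntegral.integral_congr fun s hs => ?_
      rw [uIcc_of_le ht] at hs
      change coef n (S (t - s) (G s)) = _
      rw [hS _ (sub_nonneg.2 hs.2), ← mul_assoc, ← Real.exp_add]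
      congr 2
      ring
    rw [hq, map_add, h1, hS t ht, intervalIntegral.integral_const_mul, ← mul_add]
  have hQd : ∀ t, HasDerivAt Q (μ n * Q t + coef n (G t)) t := by
    intro t
    have h1 : Continuous fun s => Real.exp (-(μ n * s)) * coef n (G s) := by fun_prop
    have h2 := (((hasDerivAt_id t).const_mul (μ n)).exp).mul
      ((h1.integral_hasStrictDerivAt 0 t).hasDerivAt.const_add (coef n (a + f 0)))
    convert! h2 using 1
    have h3 : Real.exp (μ n * t) * (Real.exp (-(μ n * t)) * coef n (G t)) = coef n (G t) := by
      rw [← mul_assoc, ← Real.exp_add, add_neg_cancel, Real.exp_zero, one_mul]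
    simp only [id, mul_one, hQ]
    rw [h3]
    ring
  -- The residual of the equation in each coefficient has derivative zero because `Q' = μ Q + f'`,
  -- and it vanishes at time `0` because `a` has the coefficients of `A z₀`.
  have hD : ∀ s, 0 ≤ s → HasDerivWithinAt
      (fun s => Q s - coef n (f s) - μ n * coef n (z s)) 0 (Ici 0) s := by
    intro s hs
    have h1 := ((hQd s).hasDerivWithinAt (s := Ici 0)).sub
      ((coef n).hasFDerivAt.comp_hasDerivWithinAt s (hf s hs))
    have h2 := h1.sub ((((coef n).hasFDerivAt.comp_hasDerivAt s (hzd s)).const_mul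
      (μ n)).hasDerivWithinAt (s := Ici 0))
    convert! h2 using 1
    rw [hqQ s hs, hG]
    simp only [max_eq_left hs]
    ring
  have hconst := constant_of_has_deriv_right_zero (a := 0) (b := t)
    (fun s hs => ((hD s hs.1).continuousWithinAt).mono Icc_subset_Ici_self)
    (fun s hs => (hD s hs.1).mono (Ici_subset_Ici.2 hs.1)) t ⟨ht, le_rfl⟩
  have h0 : Q 0 - coef n (f 0) - μ n * coef n (z 0) = 0 := by
    rw [hz0, ← ha]
    simp [hQ]
  rw [h0, ← hqQ t ht] at hconst
  rw [map_sub]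
  linarith

/-- The lifts are the parabolas `x - x² / 2` at the left end and `x² / 2` at the right end. -/
theorem exists_lift (c : Endpoint) : ∃ g : H2, dx g c.pos = 1 ∧ dx g c.other.pos = 0 := by
  cases c
  · obtain ⟨g, -, h0, h1, -⟩ := exists_h2 0 1 (ofCont (-1))
    refine ⟨g, h0, ?_⟩
    change dx g 1 = 0
    rw [h1, intervalIntegral_congr_ae_Ioo (ofCont_ae _)]
    simp
  · obtain ⟨g, -, h0, h1, -⟩ := exists_h2 0 0 (ofCont 1)
    refine ⟨g, ?_, h0⟩
    change dx g 1 = 1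
    rw [h1, intervalIntegral_congr_ae_Ioo (ofCont_ae _)]
    simp

theorem dx_ends_eq_zero {w : H2} (c : Endpoint) (h : dx w c.pos = 0) (h' : dx w c.other.pos = 0) :
    dx w 0 = 0 ∧ dx w 1 = 0 := by
  cases c
  · exact ⟨h, h'⟩
  · exact ⟨h', h⟩

theorem dx_pos_eq_zero {w : H2} (c : Endpoint) (h : dx w 0 = 0) (h' : dx w 1 = 0) :
    dx w c.pos = 0 := by
  cases c
  · exact h
  · exact h'

theorem exists_resolvent_h2 (hγ : ∀ n : ℕ, γ ≠ -((n : ℝ) * Real.pi) ^ 2) (f : X) :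
    ∃ r : H2, (r : X) = resolvent γ f ∧ dx r 0 = 0 ∧ dx r 1 = 0 ∧
      dxx r = γ • resolvent γ f - f := by
  obtain ⟨h, h0, h1, h2⟩ := mem_graph_neumann.1 (resolvent_mem_graph hγ f)
  exact ⟨⟨_, h⟩, rfl, h0, h1, h2⟩

/-- Write `w = z + u g`. Then `z` has homogeneous Neumann data and solves `z' = A z + u h₁ - u' g`;
the forcing must be `C¹`, which is where `u` in `C²` is used. -/
theorem exists_classical (ρ α β : ℝ) (hγ : ∀ n : ℕ, γ ≠ -((n : ℝ) * Real.pi) ^ 2) (c : Endpoint)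
    (u : ℝ → ℝ) (w₀ : H2) (hu : ContDiffOn ℝ 2 u (Ici 0)) (h0 : dx w₀ c.pos = u 0)
    (h0' : dx w₀ c.other.pos = 0) :
    ∃ w v : ℝ → H2, IsClassicalSolution ρ α β γ c u w v ∧ w 0 = w₀ := by
  obtain ⟨M, hM⟩ := exists_eigenA_le ρ α β γ
  set R := resolvent γ with hR
  obtain ⟨g, hg, hg'⟩ := exists_lift c
  obtain ⟨u₁, u₂, hu₁, hu₂, hu₂c⟩ : ∃ u₁ u₂ : ℝ → ℝ,
      (∀ t ∈ Ici (0 : ℝ), HasDerivWithinAt u (u₁ t) (Ici 0) t) ∧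
      (∀ t ∈ Ici (0 : ℝ), HasDerivWithinAt u₁ (u₂ t) (Ici 0) t) ∧ ContinuousOn u₂ (Ici 0) := by
    have h1 : ContDiffOn ℝ 1 (derivWithin u (Ici 0)) (Ici 0) :=
      hu.derivWithin (uniqueDiffOn_Ici 0) (by norm_num)
    refine ⟨derivWithin u (Ici 0), derivWithin (derivWithin u (Ici 0)) (Ici 0), fun t ht => ?_,
      fun t ht => ?_, ?_⟩
    · exact ((hu.differentiableOn (by norm_num)) t ht).hasDerivWithinAt
    · exact ((h1.differentiableOn (by norm_num)) t ht).hasDerivWithinAt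
    · exact h1.continuousOn_derivWithin (uniqueDiffOn_Ici 0) le_rfl
  -- The expression for `A` applied formally to `g`, which is not in the Neumann domain.
  set h₁ : X := dxx g - ρ • (g : X) + (α * β) • R g with hh₁
  set z₀ : H2 := w₀ - u 0 • g with hz₀
  have hz₀d : dx z₀ c.pos = 0 ∧ dx z₀ c.other.pos = 0 := by
    constructor
    · have := (dxₗ c.pos_mem).map_sub w₀ (u 0 • g)
      rw [map_smul] at this
      change dx z₀ c.pos = dx w₀ c.pos - u 0 • dx g c.pos at this
      rw [this, h0, hg]; simp
    · have := (dxₗ c.other.pos_mem).map_sub w₀ (u 0 • g)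
      rw [map_smul] at this
      change dx z₀ c.other.pos = dx w₀ c.other.pos - u 0 • dx g c.other.pos at this
      rw [this, h0', hg']; simp
  have hz₀e := dx_ends_eq_zero c hz₀d.1 hz₀d.2
  have ha : ∀ n, coef n (dxx z₀ - ρ • (z₀ : X) + (α * β) • R z₀) =
      eigenA ρ α β γ n * coef n (z₀ : X) := by
    intro n
    rw [map_add, map_sub, map_smul, map_smul, coef_dxx hz₀e.1 hz₀e.2, hR, coef_resolvent, eigenA,
      smul_eq_mul, smul_eq_mul]
    ring
  have hu₁c : ContinuousOn u₁ (Ici 0) := fun t ht => (hu₂ t ht).continuousWithinAt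
  obtain ⟨z, q, hq, hz0, hzd, hzq⟩ := exists_strict_solution hM ha
    (f := fun t => u t • h₁ - u₁ t • (g : X)) (F := fun t => u₁ t • h₁ - u₂ t • (g : X))
    (fun t ht => ((hu₁ t ht).smul_const h₁).sub ((hu₂ t ht).smul_const (g : X)))
    ((hu₁c.smul continuousOn_const).sub (hu₂c.smul continuousOn_const))
  -- The coefficient equation for `q - f` places `z t` in the Neumann domain and expresses its
  -- second derivative by terms continuous in time, so `z` is continuous in `H²`. Negative times get
  -- the value `0`.
  have hzH : ∀ t, ∃ y : H2, 0 ≤ t → (y : X) = z t ∧ dx y 0 = 0 ∧ dx y 1 = 0 ∧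
      dxx y = q t - (u t • h₁ - u₁ t • (g : X)) + ρ • z t - (α * β) • R (z t) := by
    intro t
    by_cases ht : 0 ≤ t
    · have hG : (z t, q t - (u t • h₁ - u₁ t • (g : X)) + ρ • z t - (α * β) • R (z t)) ∈
          neumannLaplacian.graph := by
        refine mem_graph_neumann_iff_coef.2 fun n => ?_
        rw [map_sub, map_add, hzq t ht n, map_smul, map_smul, hR, coef_resolvent, eigenA,
          smul_eq_mul, smul_eq_mul]
        ring
      obtain ⟨h, h0, h1, h2⟩ := mem_graph_neumann.1 hG
      exact ⟨⟨_, h⟩, fun _ => ⟨rfl, h0, h1, h2⟩⟩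
    · exact ⟨0, fun h => absurd h ht⟩
  choose y hy using hzH
  choose r hr hr0 hr1 hr2 using exists_resolvent_h2 hγ
  have huc : ContinuousOn u (Ici 0) := hu.continuousOn
  have hzc : Continuous z := continuous_iff_continuousAt.2 fun t => (hzd t).continuousAt
  set w : ℝ → H2 := fun t => y t + u t • g with hw
  have hwX : ∀ t ∈ Ici (0 : ℝ), (w t : X) = z t + u t • (g : X) := fun t ht => by
    rw [← (hy t ht).1]; rfl
  have hwxx : ∀ t, dxx (w t) = dxx (y t) + u t • dxx g := fun t => by
    rw [hw, (add_rules _ _).2.2, (smul_rules _ _).2.2]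
  have hwdx : ∀ t, ∀ e : Endpoint, dx (w t) e.pos = dx (y t) e.pos + u t * dx g e.pos := by
    intro t e
    rw [hw, (add_rules _ _).2.1 e.pos_mem, Pi.add_apply, (smul_rules _ _).2.1 e.pos_mem]
    rfl
  have hwc : ContinuousOn (fun t => (w t : X)) (Ici 0) :=
    (hzc.continuousOn.add (huc.smul continuousOn_const)).congr hwX
  have hvxx : ∀ t, dxx (β • r (w t)) = β • (γ • R (w t) - w t) := fun t => by
    rw [(smul_rules _ _).2.2, hr2]
  have hvX : ∀ t, ((β • r (w t) : H2) : X) = β • R (w t) := fun t => by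
    rw [Submodule.coe_smul, hr]
  have hvdx : ∀ t, ∀ e : Endpoint, dx (β • r (w t)) e.pos = 0 := fun t e => by
    rw [(smul_rules _ _).2.1 e.pos_mem, Pi.smul_apply, dx_pos_eq_zero e (hr0 _) (hr1 _), smul_zero]
  refine ⟨w, fun t => β • r (w t), ⟨hwc, ?_, ?_, ?_, fun t ht => ?_, fun t ht => ?_, fun t ht => ?_,
    fun t ht => ?_, fun t ht => hvdx t .left, fun t ht => hvdx t .right⟩, Subtype.ext ?_⟩
  · have : ContinuousOn (fun t => q t - (u t • h₁ - u₁ t • (g : X)) + ρ • z t - (α * β) • R (z t) +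
        u t • dxx g) (Ici 0) := by fun_prop
    refine this.congr fun t ht => ?_
    rw [hwxx, (hy t ht).2.2.2]
  · simp only [hvX]
    fun_prop
  · simp only [hvxx]
    fun_prop
  · have h1 := ((hzd t).hasDerivWithinAt (s := Ici 0)).add ((hu₁ t ht).smul_const (g : X))
    have h2 := h1.congr hwX (hwX t ht)
    convert! h2 using 1
    rw [hwxx, (hy t ht).2.2.2, hvX, hwX t ht, map_add, map_smul, hh₁]
    module
  · rw [hvxx, hvX]
    module
  · rw [hwdx, hg, dx_pos_eq_zero c (hy t ht).2.1 (hy t ht).2.2.1]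
    ring
  · rw [hwdx, hg', dx_pos_eq_zero _ (hy t ht).2.1 (hy t ht).2.2.1]
    ring
  · rw [hwX 0 self_mem_Ici, hz0, hz₀]
    simp

/-! ### The energy estimate -/

/-- Young's inequality splits the boundary term into `w_x(c)² + w(c)²`. The two uses of the trace
inequality, at `c` and at `o`, cost one `∫ w_x²` out of the available two, and contribute `3 + 3 =
6` to the constant. -/
theorem energy_pointwise (ρ α β γ : ℝ) (c o : Endpoint) (w : H2) (h : dx w c.other.pos = 0) :
    2 * inner ℝ (w : X) (dxx w - ρ • (w : X) + α • β • resolvent γ w) + val w o.pos ^ 2 ≤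
      dx w c.pos ^ 2 + (2 * (|ρ| + |α * β| * ‖resolvent γ‖) + 6) * ‖(w : X)‖ ^ 2 := by
  have hD : 0 ≤ ∫ x in (0 : ℝ)..1, dx w x ^ 2 :=
    intervalIntegral.integral_nonneg zero_le_one fun x _ => sq_nonneg _
  have ho := val_sq_le w o
  have hc := val_sq_le w c
  have h1 : 2 * inner ℝ (w : X) (dxx w) ≤
      dx w c.pos ^ 2 + val w c.pos ^ 2 - 2 * ∫ x in (0 : ℝ)..1, dx w x ^ 2 := by
    rw [real_inner_comm, inner_dxx_self]
    cases c
    · simp only [Endpoint.other, Endpoint.pos] at h ⊢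
      rw [h]
      nlinarith [sq_nonneg (dx w 0 + val w 0)]
    · simp only [Endpoint.other, Endpoint.pos] at h ⊢
      rw [h]
      nlinarith [sq_nonneg (dx w 1 - val w 1)]
  have h2 : -(ρ * ‖(w : X)‖ ^ 2) ≤ |ρ| * ‖(w : X)‖ ^ 2 := by
    rw [← neg_mul]
    exact mul_le_mul_of_nonneg_right (neg_le_abs ρ) (sq_nonneg _)
  have h3 : α * β * inner ℝ (w : X) (resolvent γ w) ≤
      |α * β| * ‖resolvent γ‖ * ‖(w : X)‖ ^ 2 := by
    refine (le_abs_self _).trans ?_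
    rw [abs_mul, mul_assoc]
    refine mul_le_mul_of_nonneg_left ?_ (abs_nonneg _)
    refine (abs_real_inner_le_norm _ _).trans ?_
    have := mul_le_mul_of_nonneg_left ((resolvent γ).le_opNorm (w : X)) (norm_nonneg (w : X))
    linarith
  rw [inner_add_right, inner_sub_right, inner_smul_right, inner_smul_right, inner_smul_right,
    real_inner_self_eq_norm_sq]
  linarith

section ClassicalSolution

variable {ρ α β γ : ℝ} {c : Endpoint} {u : ℝ → ℝ} {w v : ℝ → H2}

/-- Comparing cosine coefficients in the elliptic equation suffices, since the Neumann conditions on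
`v` make `v''` diagonal as well. -/
theorem IsClassicalSolution.v_eq (h : IsClassicalSolution ρ α β γ c u w v)
    (hγ : ∀ n : ℕ, γ ≠ -((n : ℝ) * Real.pi) ^ 2) {t : ℝ} (ht : t ∈ Ici (0 : ℝ)) :
    (v t : X) = β • resolvent γ (w t) := by
  refine ext_coef fun n => ?_
  have hne := gamma_add_eigen_ne_zero hγ n
  have h1 := congrArg (coef n) (h.elliptic t ht)
  rw [map_zero, map_add, map_sub, map_smul, map_smul, coef_dxx (h.v_left t ht) (h.v_right t ht),
    smul_eq_mul, smul_eq_mul] at h1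
  rw [map_smul, coef_resolvent, smul_eq_mul]
  field_simp
  linarith

theorem IsClassicalSolution.energy (h : IsClassicalSolution ρ α β γ c u w v)
    (hγ : ∀ n : ℕ, γ ≠ -((n : ℝ) * Real.pi) ^ 2) (o : Endpoint) {K : ℝ}
    (hK : K = 2 * (|ρ| + |α * β| * ‖resolvent γ‖) + 6) {T : ℝ} (hT : 0 ≤ T) :
    ‖(w T : X)‖ ^ 2 + ∫ s in (0 : ℝ)..T, val (w s) o.pos ^ 2 ≤
      Real.exp (K * T) * (‖(w 0 : X)‖ ^ 2 + ∫ s in (0 : ℝ)..T, u s ^ 2) := by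
  have hK0 : 0 ≤ K := by rw [hK]; positivity
  have hmax : ∀ s : ℝ, max s 0 ∈ Ici (0 : ℝ) := fun s => mem_Ici.2 (le_max_right _ _)
  set Y : ℝ → ℝ := fun s => val (w (max s 0)) o.pos with hY
  set U : ℝ → ℝ := fun s => dx (w (max s 0)) c.pos with hU
  have hYc : Continuous Y := (continuousOn_traces h.w_cont h.w_dxx_cont o).1.comp_continuous
    (continuous_id.max continuous_const) hmax
  have hUc : Continuous U := (continuousOn_traces h.w_cont h.w_dxx_cont c).2.comp_continuous
    (continuous_id.max continuous_const) hmax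
  -- Grönwall's argument in integrated form: the pointwise energy inequality says precisely that
  -- this weighted functional is nonincreasing. On `[0, T]` the weight lies between `exp (-K T)` and
  -- `1`, which removes it from the output and input integrals.
  set Φ : ℝ → ℝ := fun t => Real.exp (-(K * t)) * ‖(w t : X)‖ ^ 2 +
    ∫ s in (0 : ℝ)..t, Real.exp (-(K * s)) * (Y s ^ 2 - U s ^ 2) with hΦ
  have hd : ∀ t ∈ Ici (0 : ℝ), ∃ d ≤ 0, HasDerivWithinAt Φ d (Ici 0) t := by
    intro t ht
    have h1 := (((((hasDerivAt_id t).const_mul K).neg).exp).hasDerivWithinAt (s := Ici 0)).mul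
      (h.parabolic t ht).norm_sq
    have hc : Continuous fun s => Real.exp (-(K * s)) * (Y s ^ 2 - U s ^ 2) := by fun_prop
    have h2 := h1.add ((hc.integral_hasStrictDerivAt 0 t).hasDerivAt.hasDerivWithinAt (s := Ici 0))
    refine ⟨_, ?_, h2⟩
    have h3 := energy_pointwise ρ α β γ c o (w t) (h.w_other t ht)
    rw [← h.v_eq hγ ht, ← hK] at h3
    have h4 : Y t = val (w t) o.pos := by rw [hY]; simp only [max_eq_left (mem_Ici.1 ht)]
    have h5 : U t = dx (w t) c.pos := by rw [hU]; simp only [max_eq_left (mem_Ici.1 ht)]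
    rw [h4, h5]
    have h6 := mul_le_mul_of_nonneg_left h3 (Real.exp_pos (-(K * t))).le
    simp only [id, mul_one, Pi.neg_apply]
    linarith
  have hanti : AntitoneOn Φ (Ici 0) := by
    refine antitoneOn_of_deriv_nonpos (convex_Ici 0) (fun t ht => ?_) (fun t ht => ?_)
      fun t ht => ?_
    · obtain ⟨d, -, hd⟩ := hd t ht
      exact hd.continuousWithinAt
    · obtain ⟨d, -, hd⟩ := hd t (interior_subset ht)
      exact (hd.mono interior_subset).differentiableWithinAt
    · obtain ⟨d, hd0, hd⟩ := hd t (interior_subset ht)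
      rw [(hd.hasDerivAt (mem_interior_iff_mem_nhds.1 ht)).deriv]
      exact hd0
  have h1 := hanti self_mem_Ici hT hT
  have hYU : ∫ s in (0 : ℝ)..T, Real.exp (-(K * s)) * (Y s ^ 2 - U s ^ 2) =
      (∫ s in (0 : ℝ)..T, Real.exp (-(K * s)) * Y s ^ 2) -
        ∫ s in (0 : ℝ)..T, Real.exp (-(K * s)) * U s ^ 2 := by
    rw [← intervalIntegral.integral_sub (Continuous.intervalIntegrable (by fun_prop) _ _)
      (Continuous.intervalIntegrable (by fun_prop) _ _)]
    simp only [mul_sub]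
  have hYT : Real.exp (-(K * T)) * ∫ s in (0 : ℝ)..T, val (w s) o.pos ^ 2 ≤
      ∫ s in (0 : ℝ)..T, Real.exp (-(K * s)) * Y s ^ 2 := by
    have h2 : ∫ s in (0 : ℝ)..T, val (w s) o.pos ^ 2 = ∫ s in (0 : ℝ)..T, Y s ^ 2 := by
      refine intervalIntegral.integral_congr fun s hs => ?_
      rw [uIcc_of_le hT] at hs
      simp only [hY, max_eq_left hs.1]
    rw [h2, ← intervalIntegral.integral_const_mul]
    refine intervalIntegral.integral_mono_on hT (Continuous.intervalIntegrable (by fun_prop) _ _)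
      (Continuous.intervalIntegrable (by fun_prop) _ _) fun s hs => ?_
    refine mul_le_mul_of_nonneg_right (Real.exp_le_exp.2 (neg_le_neg ?_)) (sq_nonneg _)
    exact mul_le_mul_of_nonneg_left hs.2 hK0
  have hUT : ∫ s in (0 : ℝ)..T, Real.exp (-(K * s)) * U s ^ 2 ≤ ∫ s in (0 : ℝ)..T, u s ^ 2 := by
    have h2 : ∫ s in (0 : ℝ)..T, u s ^ 2 = ∫ s in (0 : ℝ)..T, U s ^ 2 := by
      refine intervalIntegral.integral_congr fun s hs => ?_
      rw [uIcc_of_le hT] at hs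
      simp only [hU, max_eq_left hs.1, h.w_control s hs.1]
    rw [h2]
    refine intervalIntegral.integral_mono_on hT (Continuous.intervalIntegrable (by fun_prop) _ _)
      (Continuous.intervalIntegrable (by fun_prop) _ _) fun s hs => ?_
    refine mul_le_of_le_one_left (sq_nonneg _) (Real.exp_le_one_iff.2 ?_)
    have := mul_nonneg hK0 hs.1
    linarith
  simp only [hΦ, hYU, intervalIntegral.integral_same, mul_zero, neg_zero, Real.exp_zero, one_mul,
    add_zero] at h1
  have h2 : Real.exp (-(K * T)) * (‖(w T : X)‖ ^ 2 + ∫ s in (0 : ℝ)..T, val (w s) o.pos ^ 2) ≤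
      ‖(w 0 : X)‖ ^ 2 + ∫ s in (0 : ℝ)..T, u s ^ 2 := by linarith
  have h3 := mul_le_mul_of_nonneg_left h2 (Real.exp_pos (K * T)).le
  rwa [← mul_assoc, ← Real.exp_add, add_neg_cancel, Real.exp_zero, one_mul] at h3

/-! ### Superposition and uniqueness -/

theorem IsClassicalSolution.add {u' : ℝ → ℝ} {w' v' : ℝ → H2}
    (h : IsClassicalSolution ρ α β γ c u w v) (h' : IsClassicalSolution ρ α β γ c u' w' v') :
    IsClassicalSolution ρ α β γ c (u + u') (w + w') (v + v') := by
  have hdx : ∀ (y z : H2) (e : Endpoint), dx (y + z) e.pos = dx y e.pos + dx z e.pos :=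
    fun y z e => (add_rules y z).2.1 e.pos_mem
  have hdxx : ∀ y z : H2, dxx (y + z) = dxx y + dxx z := fun y z => (add_rules y z).2.2
  refine ⟨h.w_cont.add h'.w_cont, ?_, h.v_cont.add h'.v_cont, ?_, fun t ht => ?_, fun t ht => ?_,
    fun t ht => ?_, fun t ht => ?_, fun t ht => ?_, fun t ht => ?_⟩
  · exact (h.w_dxx_cont.add h'.w_dxx_cont).congr fun t _ => hdxx _ _
  · exact (h.v_dxx_cont.add h'.v_dxx_cont).congr fun t _ => hdxx _ _
  · convert! (h.parabolic t ht).add (h'.parabolic t ht) using 1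
    simp only [Pi.add_apply, hdxx, Submodule.coe_add]
    module
  · simp only [Pi.add_apply, hdxx, Submodule.coe_add]
    have := congrArg₂ (· + ·) (h.elliptic t ht) (h'.elliptic t ht)
    simp only [add_zero] at this
    rw [this]
    module
  · rw [Pi.add_apply, hdx, h.w_control t ht, h'.w_control t ht, Pi.add_apply]
  · rw [Pi.add_apply, hdx, h.w_other t ht, h'.w_other t ht, add_zero]
  · exact (hdx _ _ .left).trans (by
      simp only [Endpoint.pos, h.v_left t ht, h'.v_left t ht, add_zero])
  · exact (hdx _ _ .right).trans (by
      simp only [Endpoint.pos, h.v_right t ht, h'.v_right t ht, add_zero])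

theorem IsClassicalSolution.smul (a : ℝ) (h : IsClassicalSolution ρ α β γ c u w v) :
    IsClassicalSolution ρ α β γ c (a • u) (a • w) (a • v) := by
  have hdx : ∀ (y : H2) (e : Endpoint), dx (a • y) e.pos = a * dx y e.pos :=
    fun y e => (smul_rules a y).2.1 e.pos_mem
  have hdxx : ∀ y : H2, dxx (a • y) = a • dxx y := fun y => (smul_rules a y).2.2
  refine ⟨h.w_cont.const_smul a, ?_, h.v_cont.const_smul a, ?_, fun t ht => ?_, fun t ht => ?_,
    fun t ht => ?_, fun t ht => ?_, fun t ht => ?_, fun t ht => ?_⟩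
  · exact (h.w_dxx_cont.const_smul a).congr fun t _ => hdxx _
  · exact (h.v_dxx_cont.const_smul a).congr fun t _ => hdxx _
  · convert! (h.parabolic t ht).const_smul a using 1
    simp only [Pi.smul_apply, hdxx, Submodule.coe_smul]
    module
  · simp only [Pi.smul_apply, hdxx, Submodule.coe_smul]
    have := congrArg (a • ·) (h.elliptic t ht)
    simp only [smul_zero] at this
    rw [this]
    module
  · rw [Pi.smul_apply, hdx, h.w_control t ht, Pi.smul_apply, smul_eq_mul]
  · rw [Pi.smul_apply, hdx, h.w_other t ht, mul_zero]
  · exact (hdx _ .left).trans (by simp only [Endpoint.pos, h.v_left t ht, mul_zero])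
  · exact (hdx _ .right).trans (by simp only [Endpoint.pos, h.v_right t ht, mul_zero])

/-- The difference of the solutions has zero input and zero initial state, so its energy vanishes;
`v` is then determined by `w`. -/
theorem unique_classical (hγ : ∀ n : ℕ, γ ≠ -((n : ℝ) * Real.pi) ^ 2) {w' v' : ℝ → H2}
    (h : IsClassicalSolution ρ α β γ c u w v) (h' : IsClassicalSolution ρ α β γ c u w' v')
    (h0 : w 0 = w' 0) : EqOn w w' (Ici 0) ∧ EqOn v v' (Ici 0) := by
  have hw : EqOn w w' (Ici 0) := by
    intro t ht
    have h1 := (h.add (h'.smul (-1))).energy hγ c rfl ht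
    have h2 : 0 ≤ ∫ s in (0 : ℝ)..t, val ((w + (-1 : ℝ) • w') s) c.pos ^ 2 :=
      intervalIntegral.integral_nonneg ht fun s _ => sq_nonneg _
    simp only [Pi.add_apply, Pi.neg_apply, h0, neg_smul, one_smul, add_neg_cancel,
      Submodule.coe_zero, norm_zero, ne_eq, OfNat.ofNat_ne_zero, not_false_eq_true, zero_pow,
      intervalIntegral.integral_zero, add_zero, mul_zero] at h1 h2
    have h3 : ‖((w t + -w' t : H2) : X)‖ ^ 2 ≤ 0 := by linarith
    have h4 : ((w t + -w' t : H2) : X) = 0 :=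
      norm_eq_zero.1 (pow_eq_zero_iff two_ne_zero |>.1 (le_antisymm h3 (sq_nonneg _)))
    have h5 : w t + -w' t = 0 := Subtype.ext h4
    exact add_neg_eq_zero.1 h5
  refine ⟨hw, fun t ht => Subtype.ext ?_⟩
  rw [h.v_eq hγ ht, h'.v_eq hγ ht, hw ht]

end ClassicalSolution

/-! ### The extension to a bounded operator -/

/-- A densely defined, bounded linear relation is contained in the graph of exactly one bounded
operator. -/
theorem existsUnique_clm_of_dense {E F : Type*} [NormedAddCommGroup E] [NormedSpace ℝ E]
    [NormedAddCommGroup F] [NormedSpace ℝ F] [CompleteSpace F] (G : Submodule ℝ (E × F)) {C : ℝ}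
    (hC : ∀ p ∈ G, ‖p.2‖ ≤ C * ‖p.1‖) (hd : Dense (Prod.fst '' (G : Set (E × F)))) :
    ∃! P : E →L[ℝ] F, ∀ p ∈ G, P p.1 = p.2 := by
  set f : G →ₗ[ℝ] F := LinearMap.snd ℝ E F ∘ₗ G.subtype
  set e : G →ₗ[ℝ] E := LinearMap.fst ℝ E F ∘ₗ G.subtype
  have he : DenseRange e := by
    refine hd.mono ?_
    rintro _ ⟨p, hp, rfl⟩
    exact ⟨⟨p, hp⟩, rfl⟩
  have hf : ∀ x, ‖f x‖ ≤ C * ‖e x‖ := fun x => hC x x.2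
  refine ⟨f.extendOfNorm e, fun p hp => LinearMap.extendOfNorm_eq he ⟨C, hf⟩ ⟨p, hp⟩,
    fun P hP => (LinearMap.extendOfNorm_unique he C hf P ?_).symm⟩
  ext x
  exact hP x x.2

theorem norm_sq_l2 {T : ℝ} (hT : 0 ≤ T) {U : L2 T} {u : ℝ → ℝ}
    (h : U =ᵐ[volume.restrict (Ioo (0 : ℝ) T)] u) : ‖U‖ ^ 2 = ∫ s in (0 : ℝ)..T, u s ^ 2 := by
  rw [← real_inner_self_eq_norm_sq, L2.inner_def, intervalIntegral.integral_of_le hT,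
    integral_Ioc_eq_integral_Ioo]
  refine integral_congr_ae ?_
  filter_upwards [h] with s hs
  rw [hs]
  simp [pow_two]

/-- The relation (initial state, input) ↦ (state trajectory, output) of the classical solutions. -/
def classicalRel (ρ α β γ : ℝ) (c o : Endpoint) (T : ℝ) :
    Submodule ℝ ((X × L2 T) × (C(Icc (0 : ℝ) T, X) × L2 T)) where
  carrier := {p | ∃ (u : ℝ → ℝ) (w v : ℝ → H2), IsClassicalSolution ρ α β γ c u w v ∧
    p.1.1 = w 0 ∧ p.1.2 =ᵐ[volume.restrict (Ioo (0 : ℝ) T)] u ∧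
    (∀ t : Icc (0 : ℝ) T, p.2.1 t = w t) ∧
    p.2.2 =ᵐ[volume.restrict (Ioo (0 : ℝ) T)] fun t => val (w t) o.pos}
  add_mem' := by
    rintro p p' ⟨u, w, v, h, h1, h2, h3, h4⟩ ⟨u', w', v', h', h1', h2', h3', h4'⟩
    refine ⟨u + u', w + w', v + v', h.add h', ?_, ?_, fun t => ?_, ?_⟩
    · simp [h1, h1']
    · exact (Lp.coeFn_add _ _).trans (h2.add h2')
    · simp [h3, h3']
    · refine ((Lp.coeFn_add _ _).trans (h4.add h4')).trans (Eventually.of_forall fun t => ?_)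
      exact ((add_rules _ _).1 o.pos_mem).symm
  zero_mem' := by
    have h : IsClassicalSolution ρ α β γ c 0 0 0 := by
      have hdx : ∀ e : Endpoint, dx (0 : H2) e.pos = 0 := fun e => map_zero (dxₗ e.pos_mem)
      have hdxx : dxx (0 : H2) = 0 := map_zero dxxₗ
      refine ⟨continuousOn_const, continuousOn_const (c := dxx 0), continuousOn_const,
        continuousOn_const (c := dxx 0), fun t ht => ?_, fun t ht => ?_, fun t ht => hdx c, fun t ht => hdx _,
        fun t ht => hdx .left, fun t ht => hdx .right⟩
      · simpa [hdxx] using hasDerivWithinAt_const t (Ici 0) (0 : X)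
      · simp [hdxx]
    refine ⟨0, 0, 0, h, by simp, Lp.coeFn_zero _ _ _, fun t => by simp, ?_⟩
    refine (Lp.coeFn_zero _ _ _).trans (Eventually.of_forall fun t => ?_)
    exact (map_zero (valₗ o.pos_mem)).symm
  smul_mem' := by
    rintro a p ⟨u, w, v, h, h1, h2, h3, h4⟩
    refine ⟨a • u, a • w, a • v, h.smul a, ?_, ?_, fun t => ?_, ?_⟩
    · simp [h1]
    · exact (Lp.coeFn_smul _ _).trans (h2.const_smul a)
    · simp [h3]
    · refine ((Lp.coeFn_smul _ _).trans (h4.const_smul a)).trans (Eventually.of_forall fun t => ?_)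
      exact ((smul_rules _ _).1 o.pos_mem).symm

section Extension

variable {ρ α β γ : ℝ} {c o : Endpoint} {T : ℝ}

theorem exists_mem_classicalRel {u : ℝ → ℝ} {w v : ℝ → H2}
    (h : IsClassicalSolution ρ α β γ c u w v) (o : Endpoint) {U : L2 T}
    (hU : U =ᵐ[volume.restrict (Ioo (0 : ℝ) T)] u) :
    ∃ q, (((w 0 : X), U), q) ∈ classicalRel ρ α β γ c o T ∧
      (∀ t : Icc (0 : ℝ) T, q.1 t = w t) ∧
      q.2 =ᵐ[volume.restrict (Ioo (0 : ℝ) T)] fun t => val (w t) o.pos := by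
  have hY : Continuous fun s => val (w (max s 0)) o.pos :=
    (continuousOn_traces h.w_cont h.w_dxx_cont o).1.comp_continuous
      (continuous_id.max continuous_const) fun s => mem_Ici.2 (le_max_right _ _)
  have hq : (memLp_of_continuous hY T).toLp =ᵐ[volume.restrict (Ioo (0 : ℝ) T)]
      fun t => val (w t) o.pos := by
    filter_upwards [(memLp_of_continuous hY T).coeFn_toLp, ae_restrict_mem measurableSet_Ioo]
      with s hs hs'
    rw [hs, max_eq_left hs'.1.le]
  exact ⟨(⟨fun t => w t, h.w_cont.comp_continuous continuous_subtype_val fun t => t.2.1⟩,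
    (memLp_of_continuous hY T).toLp), ⟨u, w, v, h, rfl, hU, fun t => rfl, hq⟩, fun t => rfl, hq⟩

/-- The energy estimate at every `t ≤ T` controls the supremum norm of the state, and at `T` the
norm of the output. -/
theorem classicalRel_bound (hγ : ∀ n : ℕ, γ ≠ -((n : ℝ) * Real.pi) ^ 2) (hT : 0 ≤ T) :
    ∃ C, ∀ p ∈ classicalRel ρ α β γ c o T, ‖p.2‖ ≤ C * ‖p.1‖ := by
  obtain ⟨K, hK⟩ : ∃ K, K = 2 * (|ρ| + |α * β| * ‖resolvent γ‖) + 6 := ⟨_, rfl⟩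
  have hK0 : 0 ≤ K := by rw [hK]; positivity
  -- The factor `2` comes from the maximum norm on the product: `‖a‖² + ‖U‖² ≤ 2 ‖(a, U)‖²`.
  refine ⟨√(Real.exp (K * T) * 2), ?_⟩
  rintro ⟨⟨a, U⟩, x, y⟩ ⟨u, w, v, h, h1, h2, h3, h4⟩
  simp only at h1 h2 h3 h4
  have ha : ‖a‖ ≤ ‖(a, U)‖ := norm_fst_le (a, U)
  have hU : ‖U‖ ≤ ‖(a, U)‖ := norm_snd_le (a, U)
  have hin : ∀ t, 0 ≤ t → t ≤ T → Real.exp (K * t) * (‖(w 0 : X)‖ ^ 2 +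
      ∫ s in (0 : ℝ)..t, u s ^ 2) ≤ (√(Real.exp (K * T) * 2) * ‖(a, U)‖) ^ 2 := by
    intro t ht htT
    rw [mul_pow, Real.sq_sqrt (by positivity), mul_assoc]
    have huc : ContinuousOn (fun s => u s ^ 2) (Icc 0 T) :=
      (((continuousOn_traces h.w_cont h.w_dxx_cont c).2.congr fun s hs =>
        (h.w_control s hs).symm).mono Icc_subset_Ici_self).pow 2
    have hmono : ∫ s in (0 : ℝ)..t, u s ^ 2 ≤ ∫ s in (0 : ℝ)..T, u s ^ 2 :=
      intervalIntegral.integral_mono_interval le_rfl ht htT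
        (Eventually.of_forall fun s => sq_nonneg _)
        (huc.intervalIntegrable_of_Icc hT)
    rw [← norm_sq_l2 hT h2] at hmono
    have hi : 0 ≤ ∫ s in (0 : ℝ)..t, u s ^ 2 :=
      intervalIntegral.integral_nonneg ht fun s _ => sq_nonneg _
    refine mul_le_mul (Real.exp_le_exp.2 (mul_le_mul_of_nonneg_left htT hK0)) ?_
      (by positivity) (Real.exp_pos _).le
    rw [← h1]
    have := pow_le_pow_left₀ (norm_nonneg _) ha 2
    have := pow_le_pow_left₀ (norm_nonneg _) hU 2
    linarith
  have hC : 0 ≤ √(Real.exp (K * T) * 2) * ‖(a, U)‖ := by positivity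
  rw [Prod.norm_def]
  refine max_le ?_ ?_
  · refine (ContinuousMap.norm_le _ hC).2 fun t => ?_
    rw [h3]
    refine abs_le_of_sq_le_sq' ?_ hC |>.2
    have he := h.energy hγ o hK t.2.1
    have hi : 0 ≤ ∫ s in (0 : ℝ)..t, val (w s) o.pos ^ 2 :=
      intervalIntegral.integral_nonneg t.2.1 fun s _ => sq_nonneg _
    have := hin t t.2.1 t.2.2
    linarith
  · refine abs_le_of_sq_le_sq' ?_ hC |>.2
    have he := h.energy hγ o hK hT
    have := hin T hT le_rfl
    have := sq_nonneg ‖(w T : X)‖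
    rw [norm_sq_l2 hT h4]
    linarith

theorem dense_neumann : Dense (neumannLaplacian.domain : Set X) := by
  intro x
  refine mem_closure_of_tendsto (hasSum_coef x) (Eventually.of_forall fun s => ?_)
  refine Submodule.sum_mem _ fun n _ => Submodule.smul_mem _ _ ?_
  refine LinearPMap.mem_domain_of_mem_graph (y := -eigen n • cosFun n)
    (mem_graph_neumann_iff_coef.2 fun k => ?_)
  rw [map_smul, smul_eq_mul]
  by_cases hk : k = n
  · rw [hk]
  · rw [coef_cosFun_of_ne hk, mul_zero, mul_zero]

/-- Smooth inputs are dense in `L²(0,T)`, and once `u` is fixed the compatible initial states form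
the translate by `u 0 • g` of the dense Neumann domain, so the compatibility condition costs nothing
in `L²`. -/
theorem classicalRel_dense (hγ : ∀ n : ℕ, γ ≠ -((n : ℝ) * Real.pi) ^ 2) :
    Dense (Prod.fst ''
      (classicalRel ρ α β γ c o T : Set ((X × L2 T) × (C(Icc (0 : ℝ) T, X) × L2 T)))) := by
  rw [Metric.dense_iff]
  rintro ⟨a, U⟩ ε hε
  obtain ⟨g, hg, hg'⟩ := exists_lift c
  obtain ⟨U', hU', u, hu, -, hus⟩ := (Metric.dense_iff.1 (Lp.dense_hasCompactSupport_contDiff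
    (F := ℝ) (p := 2) (μ := volume.restrict (Ioo (0 : ℝ) T)) ENNReal.ofNat_ne_top)) U ε hε
  -- Approximating `a - u 0 • g` rather than `a` makes `z + u 0 • g` both close to `a` and
  -- compatible with the input at time `0`.
  obtain ⟨z, hz, hzN⟩ := (Metric.dense_iff.1 dense_neumann) (a - u 0 • (g : X)) ε hε
  obtain ⟨hzH, hz0, hz1⟩ := hzN
  set w₀ : H2 := ⟨z, hzH⟩ + u 0 • g with hw₀
  have hdx : ∀ e : Endpoint, dx w₀ e.pos = u 0 * dx g e.pos := by
    intro e
    rw [hw₀, (add_rules _ _).2.1 e.pos_mem, Pi.add_apply, (smul_rules _ _).2.1 e.pos_mem,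
      dx_pos_eq_zero e hz0 hz1, zero_add]
    rfl
  obtain ⟨w, v, h, hw0⟩ := exists_classical ρ α β hγ c u w₀
    ((contDiff_infty.1 hus 2).contDiffOn) (by rw [hdx, hg, mul_one])
    (by rw [hdx, hg', mul_zero])
  obtain ⟨q, hq, -⟩ := exists_mem_classicalRel h o hu
  refine ⟨((w 0 : X), U'), ?_, ⟨_, hq, rfl⟩⟩
  rw [Metric.mem_ball, Prod.dist_eq, max_lt_iff]
  refine ⟨?_, hU'⟩
  rw [hw0, hw₀]
  rw [Metric.mem_ball, dist_eq_norm] at hz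
  rw [dist_eq_norm]
  convert! hz using 2
  simp only [Submodule.coe_add, Submodule.coe_smul]
  abel

theorem isWellPosed (ρ α β : ℝ) (hγ : ∀ n : ℕ, γ ≠ -((n : ℝ) * Real.pi) ^ 2) (c o : Endpoint) :
    IsWellPosed ρ α β γ c o where
  exists_classical := exists_classical ρ α β hγ c
  unique_classical _ _ _ _ _ h h' h0 := ParabolicElliptic.unique_classical hγ h h' h0
  exists_unique_extension T hT := by
    obtain ⟨C, hC⟩ := classicalRel_bound (ρ := ρ) (α := α) (β := β) (c := c) (o := o) hγ hT.le
    have key := existsUnique_clm_of_dense _ hC (classicalRel_dense hγ)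
    -- Agreement with all classical solutions is the same condition on `P` as containing the
    -- relation in its graph; trajectories are determined pointwise and outputs almost everywhere.
    refine (existsUnique_congr fun P => ⟨fun hP u w v h U hU => ?_, fun hP p hp => ?_⟩).1 key
    · obtain ⟨q, hq, hq1, hq2⟩ := exists_mem_classicalRel h o hU
      rw [hP _ hq]
      exact ⟨hq1, hq2⟩
    · obtain ⟨u, w, v, h, h1, h2, h3, h4⟩ := hp
      obtain ⟨h5, h6⟩ := hP u w v h p.1.2 h2
      rw [← h1, Prod.mk.eta] at h5 h6
      refine Prod.ext (ContinuousMap.ext fun t => (h5 t).trans (h3 t).symm) ?_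
      exact Lp.ext (h6.trans h4.symm)

end Extension

end ParabolicElliptic

end

theorem mainTheorem10 (ρ α β γ : ℝ) (hγ : ∀ n : ℕ, γ ≠ -((n : ℝ) * Real.pi) ^ 2) :
    Function.Bijective (ParabolicElliptic.ellipticOp γ) ∧
    (ParabolicElliptic.opA ρ α β γ).domain = ParabolicElliptic.neumannLaplacian.domain ∧
    ParabolicElliptic.GeneratesC0Semigroup (ParabolicElliptic.opA ρ α β γ) ∧
    ∀ c o : ParabolicElliptic.Endpoint, ParabolicElliptic.IsWellPosed ρ α β γ c o :=
  ⟨ParabolicElliptic.bijective_ellipticOp hγ, ParabolicElliptic.opA_domain ρ α β hγ,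
    ParabolicElliptic.generatesC0Semigroup_opA ρ α β hγ,
    fun c o => ParabolicElliptic.isWellPosed ρ α β hγ c o⟩
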